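/- A \emph{weighted polyhedral complex} in $\mathbb{R}^2$ means a finite polyhedral complex, pure of dimension $1$, with a positive real weight on each $1$-dimensional cell; its support is the union of its cells. It is \emph{balanced} if at every vertex the unit direction vectors of the $1$-cells emanating from it, multiplied by their weights, sum to $0$. Weight functions are extended by $0$ off the support, and weight functions of different complexes are compared, and added to form a sum of complexes, on a common refinement. A \emph{balancing} of a weighted polyhedral complex $X$ is a balanced weighted polyhedral complex $Y$ with $w_X\le w_Y$. For a balanced complex $Y$, the \emph{monomial length} $\mathrm{mlen}(Y)$ is the number of regions (connected components) of $\mathbb{R}^2\setminus Y$, and the \emph{factorization length} $\mathrm{flen}(Y)$ is the minimum of $\sum_{i=1}^m \mathrm{mlen}(Z_i)-(m-1)$ over all $m\ge 1$ and all decompositions $Y=Z_1+\dots+Z_m$ into balanced weighted polyhedral complexes. A balancing of $X$ is minimal with respect to $\mathrm{mlen}$ (respectively $\mathrm{flen}$) if no balancing of $X$ has smaller $\mathrm{mlen}$ (respectively $\mathrm{flen}$). \textbf{Theorem.} There exist a weighted polyhedral complex $X$ in $\mathbb{R}^2$, a balancing $Y_1$ of $X$ that is minimal with respect to $\mathrm{mlen}$,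 and a balancing $Y_2$ of $X$ that is minimal with respect to $\mathrm{flen}$, such that $\mathrm{mlen}(Y_1)<\mathrm{mlen}(Y_2)$ and $\mathrm{flen}(Y_1)>\mathrm{flen}(Y_2)$. -/

import Mathlib

open scoped InnerProductSpace

namespace TropicalBalancing

/-- Euclidean space `ℝᵈ`. -/
abbrev Space (d : ℕ) : Type := EuclideanSpace ℝ (Fin d)

/-- A (convex) polyhedron: a finite intersection of closed half-spaces. -/
def IsPolyhedron {d : ℕ} (P : Set (Space d)) : Prop :=
  ∃ (k : ℕ) (a : Fin k → Space d) (b : Fin k → ℝ), P = {x | ∀ i, ⟪a i, x⟫_ℝ ≤ b i}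

/-- The dimension of a (nonempty) convex set: the dimension of its affine span. -/
noncomputable def dim {d : ℕ} (P : Set (Space d)) : ℕ :=
  Module.finrank ℝ (vectorSpan ℝ P)

/-- A (finite) polyhedral complex in `ℝᵈ`: a finite collection of nonempty polyhedra, closed under
taking nonempty faces, any two of which are disjoint or meet in a common face. The faces of a
polyhedron are the subsets on which a linear functional is maximal (`IsExposed`; this includes the
polyhedron itself, and the empty set). -/
structure PolyhedralComplex (d : ℕ) where
  cells : Finset (Set (Space d))
  nonempty_of_mem : ∀ P ∈ cells, P.Nonempty
  isPolyhedron_of_mem : ∀ P ∈ cells, IsPolyhedron P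
  face_mem : ∀ P ∈ cells, ∀ F : Set (Space d), F.Nonempty → IsExposed ℝ P F → F ∈ cells
  inter_face : ∀ P ∈ cells, ∀ Q ∈ cells, IsExposed ℝ P (P ∩ Q) ∧ IsExposed ℝ Q (P ∩ Q)

/-- A positively weighted polyhedral complex, pure of codimension 1 in `ℝᵈ`. Only the values of
`weight` on the cells of dimension `d - 1` are meaningful. -/
structure WeightedComplex (d : ℕ) extends PolyhedralComplex d where
  pure : ∀ P ∈ cells, ∃ σ ∈ cells, dim σ + 1 = d ∧ P ⊆ σ
  weight : Set (Space d) → ℝ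
  weight_pos : ∀ σ ∈ cells, dim σ + 1 = d → 0 < weight σ

namespace WeightedComplex

variable {d : ℕ}

open Classical in
/-- The maximal cells, i.e. the cells of dimension `d - 1`. -/
noncomputable def facets (X : WeightedComplex d) : Finset (Set (Space d)) :=
  X.cells.filter fun σ => dim σ + 1 = d

/-- The support: the union of the maximal cells (all weights are positive). -/
def support (X : WeightedComplex d) : Set (Space d) :=
  {x | ∃ σ ∈ X.facets, x ∈ σ}

/-- The union of the cells of codimension at least 2 in `ℝᵈ`. -/
def skeleton (X : WeightedComplex d) : Set (Space d) :=
  {x | ∃ τ ∈ X.cells, dim τ + 2 ≤ d ∧ x ∈ τ}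

open Classical in
/-- The weight of `X` at a point `x` outside the skeleton: the weight of the unique maximal cell
containing `x`, and `0` if there is none. (On the skeleton this value is not used.) -/
noncomputable def weightAt (X : WeightedComplex d) (x : Space d) : ℝ :=
  ∑ σ ∈ X.facets with x ∈ σ, X.weight σ

/-- `w_X ≤ w_Y`, the comparison being made on the maximal cells of a common refinement of `X` and
`Y`, where the weight of a complex is extended by `0` off its support. -/
def WeightLE (X Y : WeightedComplex d) : Prop :=
  ∀ x, x ∉ X.skeleton → x ∉ Y.skeleton → X.weightAt x ≤ Y.weightAt x

/-- `Y = Z 0 + ... + Z (n - 1)` as weighted complexes: the weights add up on the maximal cells of a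
common refinement. -/
def IsSum (Y : WeightedComplex d) {n : ℕ} (Z : Fin n → WeightedComplex d) : Prop :=
  ∀ x, x ∉ Y.skeleton → (∀ i, x ∉ (Z i).skeleton) → Y.weightAt x = ∑ i, (Z i).weightAt x

/-- `v` is the unit normal vector of the cell `σ` along its face `τ` of one dimension less: the unit
vector parallel to `σ`, orthogonal to `τ`, pointing from `τ` into `σ`. -/
def IsUnitNormal (τ σ : Set (Space d)) (v : Space d) : Prop :=
  ‖v‖ = 1 ∧ v ∈ vectorSpan ℝ σ ∧ (∀ u ∈ vectorSpan ℝ τ, ⟪u, v⟫_ℝ = 0) ∧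
    ∀ x ∈ τ, ∀ y ∈ σ, 0 ≤ ⟪v, y - x⟫_ℝ

open Classical in
/-- The (Euclidean) balancing condition: around every cell `τ` of codimension 2 in `ℝᵈ`, the unit
normal vectors of the maximal cells containing `τ`, multiplied by the weights, sum to zero. -/
def Balanced (X : WeightedComplex d) : Prop :=
  ∀ τ ∈ X.cells, dim τ + 2 = d →
    ∃ v : Set (Space d) → Space d,
      (∀ σ ∈ X.facets, τ ⊆ σ → IsUnitNormal τ σ (v σ)) ∧
      ∑ σ ∈ X.facets with τ ⊆ σ, X.weight σ • v σ = 0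

/-- The monomial length: the number of regions (connected components of the complement of the
support) into which `X` divides `ℝᵈ`. -/
noncomputable def mlen (X : WeightedComplex d) : ℕ∞ :=
  ENat.card (ConnectedComponents ↥(X.support)ᶜ)

/-- The factorization length: the least value of `mlen Z₁ + ... + mlen Zₘ - (m - 1)` over all
factorizations `Z₁ + ... + Zₘ`, `m ≥ 1`, of `X` into balanced complexes (here `m = n + 1`). -/
noncomputable def flen (X : WeightedComplex d) : ℕ∞ :=
  ⨅ (n : ℕ) (Z : Fin (n + 1) → WeightedComplex d) (_ : ∀ i, (Z i).Balanced) (_ : X.IsSum Z),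
    (∑ i, (Z i).mlen) - n

/-- `Y` is a balancing of `X`. -/
def IsBalancing (X Y : WeightedComplex d) : Prop :=
  Y.Balanced ∧ X.WeightLE Y

/-- `Y` is a balancing of `X` that is minimal with respect to the length function `len`. -/
def IsMinimalBalancing (len : WeightedComplex d → ℕ∞) (X Y : WeightedComplex d) : Prop :=
  IsBalancing X Y ∧ ∀ Y', IsBalancing X Y' → len Y ≤ len Y'

end WeightedComplex

end TropicalBalancing

/-
`X` consists of the six rays in which the side lines of a triangle leave it. Joining the vertices to
the centroid balances `X` with 6 regions, while the sum of the three side lines is a balancing with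
`flen ≤ 3 * 2 - 2 = 4`. It remains to see that a balancing `Y` with `flen Y ≤ 4` has at least 7
regions.

The complement of a balanced support is locally convex, because a balanced complex that touches a
line from one side contains the line near the point of contact. Its regions are therefore convex,
so that points chosen next to the ends of different rays of `Z`, on suitable sides, lie in different
regions: a balanced complex `Z` containing the ends of `n` of the six rays has
`2 * mlen Z ≥ n + 2`, and the inequality is strict if `Z` does not contain the whole line spanned
by one of these rays. Distributing the six rays over the summands `Z₀, ..., Zₙ` of `Y` and summing
up, `flen Y ≤ 4` forces equality throughout. So `Y` contains the three side lines, which separate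
the seven sign patterns of the barycentric coordinates.
-/

namespace TropicalBalancing

open Set Filter Topology

section Topology

variable {X ι : Type*} [TopologicalSpace X] {F : Set X}

theorem card_le_card_connectedComponents {x : ι → X} (hx : ∀ i, x i ∈ F)
    (h : Pairwise fun i j => x j ∉ connectedComponentIn F (x i)) :
    ENat.card ι ≤ ENat.card (ConnectedComponents F) := by
  refine ENat.card_le_card_of_injective
    (f := fun i => ((⟨x i, hx i⟩ : F) : ConnectedComponents F)) fun i j hij => ?_
  by_contra hne
  refine h (Ne.symm hne) ?_
  rw [connectedComponentIn_eq_image (hx j)]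
  exact ⟨⟨x i, hx i⟩, ConnectedComponents.coe_eq_coe'.1 hij, rfl⟩

theorem card_connectedComponents_le {s : ι → Set X} (hs : ∀ i, IsPreconnected (s i))
    (hF : F = ⋃ i, s i) : ENat.card (ConnectedComponents F) ≤ ENat.card ι := by
  have hex (C : ConnectedComponents F) : ∃ (x : F) (i : ι), (x : ConnectedComponents F) = C ∧
      (x : X) ∈ s i := by
    obtain ⟨x, rfl⟩ := ConnectedComponents.surjective_coe C
    obtain ⟨i, hi⟩ := mem_iUnion.1 (hF.subset x.2)
    exact ⟨x, i, rfl, hi⟩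
  choose x i hx hi using hex
  refine ENat.card_le_card_of_injective (f := i) fun C D hCD => ?_
  have hmem : (x C : X) ∈ connectedComponentIn F (x D) :=
    (hs (i D)).subset_connectedComponentIn (hi D)
      ((subset_iUnion s (i D)).trans hF.superset) (hCD ▸ hi C)
  rw [connectedComponentIn_eq_image (x D).2] at hmem
  obtain ⟨y, hy, hyx⟩ := hmem
  rw [← hx C, ← hx D, ConnectedComponents.coe_eq_coe', ← Subtype.ext hyx]
  exact hy

end Topology

theorem exists_pairwise_of_eventually {ι X : Type*} [Finite ι] [Nonempty X] {R : X → X → Prop}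
    (hsymm : ∀ x y, R x y → R y x) {F : ι → Filter X} [∀ i, (F i).NeBot] {A : ι → Set X}
    (hA : ∀ i, A i ∈ F i) (hR : Pairwise fun i j => ∀ᶠ y in F j, ∀ᶠ x in F i, R x y) :
    ∃ x : ι → X, (∀ i, x i ∈ A i) ∧ Pairwise fun i j => R (x i) (x j) := by
  classical
  have := Fintype.ofFinite ι
  suffices h : ∀ S : Finset ι, ∀ A : ι → Set X, (∀ i ∈ S, A i ∈ F i) →
      ∃ x : ι → X, (∀ i ∈ S, x i ∈ A i) ∧ (S : Set ι).Pairwise fun i j => R (x i) (x j) by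
    simpa [Set.pairwise_univ] using h Finset.univ A fun i _ => hA i
  intro S
  induction S using Finset.induction_on with
  | empty => exact fun _ _ => ⟨fun _ => Classical.arbitrary X, by simp⟩
  | insert a s has ih =>
    intro A hA
    have hne {i} (hi : i ∈ s) : i ≠ a := ne_of_mem_of_not_mem hi has
    obtain ⟨y, hy, hyA⟩ : ∃ y, (∀ i ∈ s, ∀ᶠ x in F i, R x y) ∧ y ∈ A a :=
      (((Finset.eventually_all s).2 fun i hi => hR (hne hi)).and
        (hA a (Finset.mem_insert_self a s))).exists
    obtain ⟨x, hxA, hx⟩ := ih (fun i => A i ∩ {x | R x y}) fun i hi =>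
      inter_mem (hA i (Finset.mem_insert_of_mem hi)) (hy i hi)
    refine ⟨Function.update x a y, ?_, ?_⟩
    · rw [Finset.forall_mem_insert, Function.update_self]
      refine ⟨hyA, fun i hi => ?_⟩
      rw [Function.update_of_ne (hne hi)]
      exact (hxA i hi).1
    · have : Std.Symm fun i j => R (Function.update x a y i) (Function.update x a y j) :=
        ⟨fun _ _ => hsymm _ _⟩
      rw [Finset.coe_insert, Set.pairwise_insert_of_symm_of_notMem (Finset.mem_coe.not.2 has)]
      refine ⟨fun i hi j hj hij => ?_, fun i hi => ?_⟩
      · simpa only [Function.update_of_ne (hne hi), Function.update_of_ne (hne hj)]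
          using hx hi hj hij
      · simpa only [Function.update_self, Function.update_of_ne (hne hi)]
          using hsymm _ _ (hxA i hi).2

section Convexity

variable {E : Type*} [AddCommGroup E] [Module ℝ E]

theorem exists_eventually_add_smul_mem {S : Set (Set E)} (hS : S.Finite)
    (hconv : ∀ σ ∈ S, Convex ℝ σ) {a v : E}
    (h : ∃ᶠ t : ℝ in atTop, ∃ σ ∈ S, a + t • v ∈ σ) :
    ∃ σ ∈ S, ∀ᶠ t : ℝ in atTop, a + t • v ∈ σ := by
  obtain ⟨σ, hσ, hfreq⟩ : ∃ σ ∈ S, ∃ᶠ t : ℝ in atTop, a + t • v ∈ σ := by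
    by_contra! hcon
    refine h ?_
    simp only [not_exists, not_and]
    exact (eventually_all_finite hS).2 fun σ hσ => hcon σ hσ
  have hord : ((fun t : ℝ => a + t • v) ⁻¹' σ).OrdConnected := by
    have hline : (fun t : ℝ => a + t • v) = (AffineMap.lineMap a (a + v) : ℝ →ᵃ[ℝ] E) := by
      funext t
      simp [AffineMap.lineMap_apply, add_comm]
    rw [hline]
    exact ((hconv σ hσ).affine_preimage _).ordConnected
  obtain ⟨s, hs⟩ := hfreq.exists
  refine ⟨σ, hσ, (eventually_ge_atTop s).mono fun t hst => ?_⟩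
  obtain ⟨u, htu, hu⟩ := frequently_atTop.1 hfreq t
  exact hord.out hs hu ⟨hst, htu⟩

end Convexity

theorem isExposed_singleton {E : Type*} [TopologicalSpace E] [AddCommGroup E] [Module ℝ E]
    {P : Set E} {q : E} (hq : q ∈ P) (l : StrongDual ℝ E) (hl : ∀ y ∈ P, y ≠ q → l y < l q) :
    IsExposed ℝ P {q} := by
  refine fun _ => ⟨l, Subset.antisymm ?_ fun x hx => ?_⟩
  · rintro x rfl
    exact ⟨hq, fun y hy => by
      rcases eq_or_ne y x with rfl | hne
      exacts [le_rfl, (hl y hy hne).le]⟩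
  · by_contra hne
    exact (hl x hx.1 hne).not_ge (hx.2 q hq)

theorem IsPolyhedron.isClosed {d : ℕ} {P : Set (Space d)} (h : IsPolyhedron P) : IsClosed P := by
  obtain ⟨k, a, b, rfl⟩ := h
  simp only [ofPred_forall]
  exact isClosed_iInter fun i => isClosed_le (by fun_prop) (by fun_prop)

theorem IsPolyhedron.convex {d : ℕ} {P : Set (Space d)} (h : IsPolyhedron P) : Convex ℝ P := by
  obtain ⟨k, a, b, rfl⟩ := h
  simp only [ofPred_forall]
  exact convex_iInter fun i => convex_halfSpace_le (innerₛₗ ℝ (a i)).isLinear _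

namespace WeightedComplex

variable {d : ℕ} (Z : WeightedComplex d)

theorem mem_facets {σ : Set (Space d)} : σ ∈ Z.facets ↔ σ ∈ Z.cells ∧ dim σ + 1 = d := by
  simp [facets]

theorem support_eq_biUnion : Z.support = ⋃ σ ∈ Z.facets, σ := by
  ext x
  simp [support]

variable {Z} in
theorem isPolyhedron_of_mem_facets {σ : Set (Space d)} (h : σ ∈ Z.facets) : IsPolyhedron σ :=
  Z.isPolyhedron_of_mem σ (Z.mem_facets.1 h).1

theorem isClosed_support : IsClosed Z.support := by
  rw [support_eq_biUnion]
  exact Z.facets.finite_toSet.isClosed_biUnion fun σ hσ => (isPolyhedron_of_mem_facets hσ).isClosed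

variable {Z} in
theorem weight_pos_of_mem_facets {σ : Set (Space d)} (h : σ ∈ Z.facets) : 0 < Z.weight σ :=
  Z.weight_pos σ (Z.mem_facets.1 h).1 (Z.mem_facets.1 h).2

open scoped Classical in
theorem weightAt_nonneg (x : Space d) : 0 ≤ Z.weightAt x :=
  Finset.sum_nonneg fun _ hσ => (weight_pos_of_mem_facets (Finset.mem_filter.1 hσ).1).le

open scoped Classical in
theorem weightAt_pos_iff {x : Space d} : 0 < Z.weightAt x ↔ x ∈ Z.support := by
  refine ⟨fun h => ?_, fun ⟨σ, hσ, hx⟩ => ?_⟩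
  · obtain ⟨σ, hσ, -⟩ := Finset.exists_ne_zero_of_sum_ne_zero h.ne'
    exact ⟨σ, Finset.mem_filter.1 hσ⟩
  · exact Finset.sum_pos (fun τ hτ => weight_pos_of_mem_facets (Finset.mem_filter.1 hτ).1)
      ⟨σ, Finset.mem_filter.2 ⟨hσ, hx⟩⟩

open MeasureTheory in
theorem dense_compl_support : Dense Z.supportᶜ := by
  have hnull : (volume : Measure (Space d)) Z.support = 0 := by
    rw [support_eq_biUnion]
    refine (measure_biUnion_null_iff Z.facets.countable_toSet).2 fun σ hσ => ?_
    refine measure_mono_null (subset_affineSpan ℝ σ)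
      (Measure.addHaar_affineSubspace _ _ fun htop => ?_)
    have hdim := (Z.mem_facets.1 hσ).2
    rw [dim, ← direction_affineSpan, htop, AffineSubspace.direction_top, finrank_top,
      finrank_euclideanSpace_fin] at hdim
    omega
  rw [← interior_eq_empty_iff_dense_compl]
  exact Measure.interior_eq_empty_of_null hnull

theorem exists_isMinimalBalancing (len : WeightedComplex d → ℕ∞) {X Y : WeightedComplex d}
    (hY : X.IsBalancing Y) : ∃ Y', IsMinimalBalancing len X Y' ∧ len Y' ≤ len Y := by
  obtain ⟨Y', hY', hmin⟩ :=
    (InvImage.wf len wellFounded_lt).has_min {Y | X.IsBalancing Y} ⟨Y, hY⟩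
  have hle : ∀ Z, X.IsBalancing Z → len Y' ≤ len Z := fun Z hZ => not_lt.1 (hmin Z hZ)
  exact ⟨Y', ⟨hY', hle⟩, hle Y hY⟩

end WeightedComplex

section Emanates

variable {E : Type*} [AddCommGroup E] [Module ℝ E] {K σ : Set E} {z u : E}

/-- `K` contains an initial piece of the ray from `z` in the direction `u`: the local form of a
cell of a complex at one of its points. -/
def Emanates (K : Set E) (z u : E) : Prop :=
  ∀ᶠ t : ℝ in 𝓝[>] 0, z + t • u ∈ K

theorem Emanates.mono (h : Emanates σ z u) (hσ : σ ⊆ K) : Emanates K z u :=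
  Eventually.mono h fun _ ht => hσ ht

theorem emanates_of_convex (hσ : Convex ℝ σ) (hz : z ∈ σ) {c : ℝ} (hc : 0 < c)
    (h : z + c • u ∈ σ) : Emanates σ z u := by
  filter_upwards [Ioc_mem_nhdsGT hc] with t ht
  have := hσ.add_smul_mem hz h (t := t / c) ⟨div_nonneg ht.1.le hc.le, (div_le_one hc).2 ht.2⟩
  rwa [smul_smul, div_mul_cancel₀ _ hc.ne'] at this

theorem Emanates.eventually_nhds (hz : z ∈ K) (h : Emanates K z u) (h' : Emanates K z (-u)) :
    ∀ᶠ t : ℝ in 𝓝 0, z + t • u ∈ K := by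
  have hneg : Tendsto Neg.neg (𝓝[<] (0 : ℝ)) (𝓝[>] 0) := by
    simpa using tendsto_neg_nhdsLT (a := (0 : ℝ))
  rw [← nhdsNE_sup_pure, ← nhdsLT_sup_nhdsGT, eventually_sup, eventually_sup, eventually_pure]
  refine ⟨⟨(hneg.eventually h').mono fun t ht => ?_, h⟩, ?_⟩
  · simpa using ht
  · simpa using hz

end Emanates

section Affine

variable {E : Type*} [AddCommGroup E] [Module ℝ E] {K : Set E} {z u : E}

theorem apply_add_smul (f : E →ᵃ[ℝ] ℝ) (z u : E) (t : ℝ) :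
    f (z + t • u) = f z + t * f.linear u := by
  simpa [add_comm] using f.map_vadd z (t • u)

theorem exists_smul_eq_of_mem {W : Submodule ℝ E} (hW : Module.finrank ℝ W = 1) {v : E}
    (hu : u ∈ W) (hu0 : u ≠ 0) (hv : v ∈ W) : ∃ c : ℝ, c • u = v := by
  obtain ⟨c, hc⟩ := exists_smul_eq_of_finrank_eq_one hW (x := ⟨u, hu⟩)
    (fun h => hu0 (congrArg Subtype.val h)) ⟨v, hv⟩
  exact ⟨c, congrArg Subtype.val hc⟩

variable [TopologicalSpace E] [ContinuousAdd E] [ContinuousSMul ℝ E]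

theorem tendsto_add_smul_nhdsGT (z u : E) :
    Tendsto (fun t : ℝ => z + t • u) (𝓝[>] 0) (𝓝 z) := by
  have hcont : Continuous fun t : ℝ => z + t • u := by fun_prop
  simpa using (hcont.tendsto 0).mono_left nhdsWithin_le_nhds

theorem Emanates.linear_nonneg {f : E →ᵃ[ℝ] ℝ} (hf : IsLocalMinOn f K z) (h : Emanates K z u) :
    0 ≤ f.linear u := by
  have hmin : ∀ᶠ t : ℝ in 𝓝[>] 0, f z ≤ f (z + t • u) :=
    (tendsto_nhdsWithin_iff.2 ⟨tendsto_add_smul_nhdsGT z u, h⟩).eventually hf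
  obtain ⟨t, ht, ht0⟩ := (hmin.and self_mem_nhdsWithin).exists
  rw [apply_add_smul, le_add_iff_nonneg_right] at ht
  exact nonneg_of_mul_nonneg_right ht ht0

theorem mem_closure_pos {f : E →ᵃ[ℝ] ℝ} (hf : f.linear ≠ 0) (hz : f z = 0) :
    z ∈ closure {x | 0 < f x} := by
  obtain ⟨u, hu⟩ : ∃ u, 0 < f.linear u := by
    obtain ⟨u, hu⟩ := DFunLike.ne_iff.1 hf
    rcases lt_or_gt_of_ne hu with hu | hu
    exacts [⟨-u, by simpa using hu⟩, ⟨u, hu⟩]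
  refine mem_closure_of_tendsto (tendsto_add_smul_nhdsGT z u)
    (eventually_mem_nhdsWithin.mono fun t ht => ?_)
  rw [mem_ofPred_eq, apply_add_smul, hz, zero_add]
  exact mul_pos ht hu

end Affine

theorem exists_smul_eq_of_apply_eq_zero {f : Space 2 →ₗ[ℝ] ℝ} (hf : f ≠ 0) {u v : Space 2}
    (hu0 : u ≠ 0) (hu : f u = 0) (hv : f v = 0) : ∃ c : ℝ, c • u = v := by
  refine exists_smul_eq_of_mem (W := LinearMap.ker f) ?_ hu hu0 hv
  have := Module.Dual.finrank_ker_add_one_of_ne_zero (f := f) hf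
  rw [finrank_euclideanSpace_fin] at this
  omega

theorem eventually_mem_of_eventually_add_smul_mem {K : Set (Space 2)} {f : Space 2 →ᵃ[ℝ] ℝ}
    (hf : f.linear ≠ 0) {z u : Space 2} (hu0 : u ≠ 0) (hu : f.linear u = 0)
    (h : ∀ᶠ t : ℝ in 𝓝 0, z + t • u ∈ K) : ∀ᶠ x in 𝓝 z, f x = f z → x ∈ K := by
  obtain ⟨l, hl⟩ := SeparatingDual.exists_eq_one (R := ℝ) hu0
  have htends : Tendsto (fun x => l (x - z)) (𝓝 z) (𝓝 0) := by
    have hcont : Continuous fun x => l (x - z) := by fun_prop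
    simpa using hcont.tendsto z
  filter_upwards [htends.eventually h] with x hx hfx
  obtain ⟨c, hc⟩ := exists_smul_eq_of_apply_eq_zero hf hu0 hu (v := x - z) <| by
    simpa [hfx] using f.linearMap_vsub x z
  rw [← hc, map_smul, hl, smul_eq_mul, mul_one, hc, add_sub_cancel] at hx
  exact hx

section Sum

variable {ι : Type*} {s : Finset ι} {w : ι → ℝ} {i : ι}

theorem apply_eq_zero_of_sum_smul_eq_zero {E : Type*} [AddCommGroup E] [Module ℝ E] {v : ι → E}
    (hw : ∀ i ∈ s, 0 < w i) (hsum : ∑ i ∈ s, w i • v i = 0) {f : E →ₗ[ℝ] ℝ}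
    (hf : ∀ i ∈ s, 0 ≤ f (v i)) (hi : i ∈ s) : f (v i) = 0 := by
  have hfsum := congrArg f hsum
  simp only [map_sum, map_smul, map_zero, smul_eq_mul] at hfsum
  have hwf := (Finset.sum_eq_zero_iff_of_nonneg fun j hj =>
    mul_nonneg (hw j hj).le (hf j hj)).1 hfsum i hi
  exact (mul_eq_zero.1 hwf).resolve_left (hw i hi).ne'

theorem exists_inner_neg_of_sum_smul_eq_zero {E : Type*} [NormedAddCommGroup E]
    [InnerProductSpace ℝ E] {v : ι → E} (hw : ∀ i ∈ s, 0 < w i) (hsum : ∑ i ∈ s, w i • v i = 0)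
    (hi : i ∈ s) (hvi : v i ≠ 0) : ∃ j ∈ s, ⟪v i, v j⟫_ℝ < 0 := by
  by_contra! hcon
  exact hvi (inner_self_eq_zero (𝕜 := ℝ).1
    (apply_eq_zero_of_sum_smul_eq_zero hw hsum (f := innerₛₗ ℝ (v i)) hcon hi))

end Sum

section Facet

variable {d : ℕ} {σ : Set (Space d)} {z : Space d}

theorem nontrivial_of_dim_eq_one (hdim : dim σ = 1) : σ.Nontrivial := by
  rw [← not_subsingleton_iff, ← vectorSpan_eq_bot_iff_subsingleton ℝ, ← Submodule.finrank_eq_zero]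
  exact hdim.trans_ne one_ne_zero

theorem exists_smul_eq_sub_of_dim_eq_one (hdim : dim σ = 1) (hz : z ∈ σ) :
    ∃ u ≠ 0, z + u ∈ σ ∧ ∀ v ∈ vectorSpan ℝ σ, ∃ c : ℝ, c • u = v := by
  obtain ⟨y, hy, hne⟩ := (nontrivial_of_dim_eq_one hdim).exists_ne z
  exact ⟨y - z, sub_ne_zero.2 hne, by simpa using hy, fun v hv =>
    exists_smul_eq_of_mem hdim (vsub_mem_vectorSpan ℝ hy hz) (sub_ne_zero.2 hne) hv⟩

theorem WeightedComplex.IsUnitNormal.emanates {v : Space d} (hdim : dim σ = 1)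
    (hσ : Convex ℝ σ) (hz : z ∈ σ) (hv : IsUnitNormal {z} σ v) : Emanates σ z v := by
  obtain ⟨hnorm, hspan, -, hpos⟩ := hv
  obtain ⟨u, hu0, hu, hprop⟩ := exists_smul_eq_sub_of_dim_eq_one hdim hz
  obtain ⟨c, rfl⟩ := hprop v hspan
  have hinner : 0 ≤ c * ⟪u, u⟫_ℝ := by simpa [inner_smul_left] using hpos z rfl (z + u) hu
  have hc : 0 < c := by
    refine (nonneg_of_mul_nonneg_left hinner (real_inner_self_pos.2 hu0)).lt_of_ne' ?_
    rintro rfl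
    simp at hnorm
  refine emanates_of_convex hσ hz (inv_pos.2 hc) ?_
  rwa [inv_smul_smul₀ hc.ne']

theorem exists_emanates_neg_of_not_isExposed (hdim : dim σ = 1) (hσ : Convex ℝ σ) (hz : z ∈ σ)
    (hexp : ¬ IsExposed ℝ σ {z}) : ∃ u ≠ 0, Emanates σ z u ∧ Emanates σ z (-u) := by
  obtain ⟨u, hu0, hu, hprop⟩ := exists_smul_eq_sub_of_dim_eq_one hdim hz
  obtain ⟨l, hl⟩ := SeparatingDual.exists_eq_one (R := ℝ) hu0
  obtain ⟨y, hy, hyz, hly⟩ : ∃ y ∈ σ, y ≠ z ∧ l y ≤ l z := by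
    by_contra! hcon
    exact hexp (isExposed_singleton hz (-l) (by simpa using hcon))
  obtain ⟨c, hc⟩ := hprop (y - z) (vsub_mem_vectorSpan ℝ hy hz)
  obtain rfl : z + c • u = y := by rw [hc, add_sub_cancel]
  have hc0 : c < 0 := by
    refine lt_of_le_of_ne ?_ ?_
    · simpa [hl] using hly
    · rintro rfl
      simp at hyz
  refine ⟨u, hu0, emanates_of_convex hσ hz one_pos ?_, emanates_of_convex hσ hz (neg_pos.2 hc0) ?_⟩
  · rwa [one_smul]
  · rwa [neg_smul_neg]

end Facet

namespace WeightedComplex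

variable {Z : WeightedComplex 2} {z : Space 2}

theorem dim_eq_one_of_mem_facets {σ : Set (Space 2)} (h : σ ∈ Z.facets) : dim σ = 1 := by
  have := (Z.mem_facets.1 h).2
  omega

theorem facet_subset_support {σ : Set (Space 2)} (h : σ ∈ Z.facets) : σ ⊆ Z.support :=
  fun _ hx => ⟨σ, h, hx⟩

theorem Balanced.exists_emanates_neg_of_singleton_mem_cells (hZ : Z.Balanced)
    (hz : z ∈ Z.support) (hcell : {z} ∈ Z.cells) {f : Space 2 →ₗ[ℝ] ℝ} (hf0 : f ≠ 0)
    (hf : ∀ u, Emanates Z.support z u → 0 ≤ f u) :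
    ∃ u ≠ 0, f u = 0 ∧ Emanates Z.support z u ∧ Emanates Z.support z (-u) := by
  classical
  obtain ⟨v, hv, hsum⟩ := hZ {z} hcell (by simp [dim])
  simp only [singleton_subset_iff] at hv hsum
  set S := {σ ∈ Z.facets | z ∈ σ}
  have hw : ∀ σ ∈ S, 0 < Z.weight σ := fun σ hσ =>
    weight_pos_of_mem_facets (Finset.mem_filter.1 hσ).1
  have hem : ∀ σ ∈ S, Emanates Z.support z (v σ) := fun σ hσS => by
    obtain ⟨hσ, hzσ⟩ := Finset.mem_filter.1 hσS
    exact ((hv σ hσ hzσ).emanates (dim_eq_one_of_mem_facets hσ)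
      (isPolyhedron_of_mem_facets hσ).convex hzσ).mono (facet_subset_support hσ)
  have hnorm : ∀ σ ∈ S, ‖v σ‖ = 1 := fun σ hσ =>
    (hv σ (Finset.mem_filter.1 hσ).1 (Finset.mem_filter.1 hσ).2).1
  have hf_zero : ∀ σ ∈ S, f (v σ) = 0 := fun σ hσ =>
    apply_eq_zero_of_sum_smul_eq_zero hw hsum (fun ρ hρ => hf _ (hem ρ hρ)) hσ
  obtain ⟨σ, hσ⟩ : ∃ σ, σ ∈ S := hz.imp fun σ hσ => Finset.mem_filter.2 hσ
  have hvσ0 : v σ ≠ 0 := norm_ne_zero_iff.1 ((hnorm σ hσ).trans_ne one_ne_zero)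
  obtain ⟨ρ, hρ, hneg⟩ := exists_inner_neg_of_sum_smul_eq_zero hw hsum hσ hvσ0
  obtain ⟨c, hc⟩ := exists_smul_eq_of_apply_eq_zero hf0 hvσ0 (hf_zero σ hσ) (hf_zero ρ hρ)
  have hc0 : c < 0 := by simpa [← hc, inner_smul_right, hnorm σ hσ] using hneg
  have hc1 : c = -1 := by
    have habs := hnorm ρ hρ
    rw [← hc, norm_smul, hnorm σ hσ, mul_one, Real.norm_eq_abs, abs_of_neg hc0] at habs
    linarith
  refine ⟨v σ, hvσ0, hf_zero σ hσ, hem σ hσ, ?_⟩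
  rw [← neg_one_smul ℝ, ← hc1, hc]
  exact hem ρ hρ

theorem Balanced.exists_emanates_neg (hZ : Z.Balanced) (hz : z ∈ Z.support)
    {f : Space 2 →ₗ[ℝ] ℝ} (hf0 : f ≠ 0) (hf : ∀ u, Emanates Z.support z u → 0 ≤ f u) :
    ∃ u ≠ 0, f u = 0 ∧ Emanates Z.support z u ∧ Emanates Z.support z (-u) := by
  by_cases hcell : {z} ∈ Z.cells
  · exact hZ.exists_emanates_neg_of_singleton_mem_cells hz hcell hf0 hf
  obtain ⟨σ, hσ, hzσ⟩ := hz
  obtain ⟨u, hu0, hu, hu'⟩ := exists_emanates_neg_of_not_isExposed (dim_eq_one_of_mem_facets hσ)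
    (isPolyhedron_of_mem_facets hσ).convex hzσ fun hexp =>
      hcell (Z.face_mem σ (Z.mem_facets.1 hσ).1 {z} (singleton_nonempty z) hexp)
  have hem := hu.mono (facet_subset_support hσ)
  have hem' := hu'.mono (facet_subset_support hσ)
  exact ⟨u, hu0, le_antisymm (by simpa using hf _ hem') (hf _ hem), hem, hem'⟩

theorem Balanced.eventually_mem_support_of_isLocalMinOn (hZ : Z.Balanced) (hz : z ∈ Z.support)
    {f : Space 2 →ᵃ[ℝ] ℝ} (hf0 : f.linear ≠ 0) (hf : IsLocalMinOn f Z.support z) :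
    ∀ᶠ x in 𝓝 z, f x = f z → x ∈ Z.support := by
  obtain ⟨u, hu0, hfu, hu, hu'⟩ :=
    hZ.exists_emanates_neg hz hf0 fun _ hu => hu.linear_nonneg hf
  exact eventually_mem_of_eventually_add_smul_mem hf0 hu0 hfu (hu.eventually_nhds hz hu')

end WeightedComplex

theorem exists_isMinOn_lex {X : Type*} [TopologicalSpace X] {K : Set X} (hK : IsCompact K)
    (hne : K.Nonempty) {g h : X → ℝ} (hg : ContinuousOn g K) (hh : ContinuousOn h K) :
    ∃ z ∈ K, (∀ x ∈ K, g z ≤ g x) ∧ ∀ x ∈ K, g x = g z → h z ≤ h x := by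
  obtain ⟨y, hy, hmin⟩ := hK.exists_isMinOn hne hg
  have hK' : IsCompact (K ∩ g ⁻¹' {g y}) := by
    obtain ⟨C, hC, hCeq⟩ := continuousOn_iff_isClosed.1 hg {g y} isClosed_singleton
    rw [inter_comm, hCeq, inter_comm]
    exact hK.inter_right hC
  obtain ⟨z, ⟨hz, hzy⟩, hmin'⟩ := hK'.exists_isMinOn ⟨y, hy, rfl⟩ (hh.mono inter_subset_left)
  rw [mem_preimage, mem_singleton_iff] at hzy
  exact ⟨z, hz, fun x hx => hzy.trans_le (hmin hx), fun x hx hxz => hmin' ⟨hx, hxz.trans hzy⟩⟩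

section Segment

variable {E : Type*} [AddCommGroup E] [Module ℝ E] {p q r : E}

theorem segment_subset_union_of_mem (h : q ∈ segment ℝ p r) :
    segment ℝ p r ⊆ segment ℝ p q ∪ segment ℝ q r := by
  rw [segment_eq_image_lineMap] at h
  obtain ⟨s, hs, rfl⟩ := h
  have himage (x y : ℝ) : AffineMap.lineMap p r '' segment ℝ x y =
      segment ℝ (AffineMap.lineMap p r x) (AffineMap.lineMap p r y) := image_segment ℝ _ x y
  have h₁ := himage 0 s
  have h₂ := himage s 1
  rw [AffineMap.lineMap_apply_zero, segment_eq_Icc hs.1] at h₁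
  rw [AffineMap.lineMap_apply_one, segment_eq_Icc hs.2] at h₂
  rw [← h₁, ← h₂, ← image_union, Icc_union_Icc_eq_Icc hs.1 hs.2, segment_eq_image_lineMap]

theorem segment_subset_union_of_collinear (h : Collinear ℝ {p, q, r}) :
    segment ℝ p r ⊆ segment ℝ p q ∪ segment ℝ q r := by
  rcases h.wbtw_or_wbtw_or_wbtw with h | h | h
  · exact segment_subset_union_of_mem h.mem_segment
  · refine ((convex_segment p q).segment_subset (left_mem_segment ℝ p q) ?_).trans
      subset_union_left
    exact h.symm.mem_segment
  · refine ((convex_segment q r).segment_subset ?_ (right_mem_segment ℝ q r)).trans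
      subset_union_right
    exact h.symm.mem_segment

end Segment

section Barycentric

variable {E : Type*} [AddCommGroup E] [Module ℝ E] (b : AffineBasis (Fin 3) ℝ E)

theorem sum_fin_three_cyclic {M : Type*} [AddCommMonoid M] (k : Fin 3) (g : Fin 3 → M) :
    ∑ i, g i = g k + g (k + 1) + g (k + 2) := by
  rw [← Equiv.sum_comp (Equiv.addLeft k), Fin.sum_univ_three]
  simp

theorem coord_add_coord_add_coord (k : Fin 3) (x : E) :
    b.coord k x + b.coord (k + 1) x + b.coord (k + 2) x = 1 := by
  rw [← sum_fin_three_cyclic k fun i => b.coord i x, b.sum_coord_apply_eq_one]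

theorem mem_segment_of_coord_eq_zero {k : Fin 3} {x : E} (hk : b.coord k x = 0)
    (h₁ : 0 ≤ b.coord (k + 1) x) (h₂ : 0 ≤ b.coord (k + 2) x) :
    x ∈ segment ℝ (b (k + 1)) (b (k + 2)) := by
  refine ⟨_, _, h₁, h₂, ?_, ?_⟩
  · simpa [hk] using coord_add_coord_add_coord b k x
  · simpa [hk, sum_fin_three_cyclic k] using b.linear_combination_coord_eq_self x

end Barycentric

section Pencil

variable {E : Type*} [NormedAddCommGroup E] [NormedSpace ℝ E] (b : AffineBasis (Fin 3) ℝ E)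

theorem continuous_coord (i : Fin 3) : Continuous (b.coord i) :=
  have := b.finiteDimensional
  (b.coord i).continuous_of_finiteDimensional

theorem exists_isMinOn_pencil {K : Set E}
    (hK : IsCompact K) (hne : K.Nonempty) (h₁ : ∀ x ∈ K, 0 ≤ b.coord 1 x)
    (h₂ : ∀ x ∈ K, 0 < b.coord 2 x) :
    ∃ a ∈ Icc (0 : ℝ) 1, ∃ z ∈ K, (1 - a) * b.coord 2 z = a * b.coord 1 z ∧
      (∀ x ∈ K, a * b.coord 1 x ≤ (1 - a) * b.coord 2 x) ∧
      ∀ x ∈ K, (1 - a) * b.coord 2 x = a * b.coord 1 x → b.coord 0 z ≤ b.coord 0 x := by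
  have hpos : ∀ x ∈ K, 0 < b.coord 1 x + b.coord 2 x := fun x hx =>
    add_pos_of_nonneg_of_pos (h₁ x hx) (h₂ x hx)
  obtain ⟨z, hz, hmin, hmin'⟩ := exists_isMinOn_lex hK hne
    (g := fun x => b.coord 2 x / (b.coord 1 x + b.coord 2 x)) (h := b.coord 0)
    ((continuous_coord b 2).continuousOn.div
      ((continuous_coord b 1).add (continuous_coord b 2)).continuousOn fun x hx => (hpos x hx).ne')
    (continuous_coord b 0).continuousOn
  refine ⟨_, ⟨div_nonneg (h₂ z hz).le (hpos z hz).le, ?_⟩, z, hz, ?_, fun x hx => ?_,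
    fun x hx hxz => hmin' x hx ?_⟩
  · exact div_le_one_of_le₀ (le_add_of_nonneg_left (h₁ z hz)) (hpos z hz).le
  · field_simp [(hpos z hz).ne']
    ring
  · have := (le_div_iff₀ (hpos x hx)).1 (hmin x hx)
    linarith
  · rw [div_eq_iff (hpos x hx).ne']
    linarith

theorem linear_pencil_ne_zero (a : ℝ) : ((1 - a) • b.coord 2 - a • b.coord 1).linear ≠ 0 :=
  fun h => by
    have := ((1 - a) • b.coord 2 - a • b.coord 1).linearMap_vsub (b 2) (b 1)
    simp [h] at this

theorem exists_coord_lt_of_mem_nhds {z : E} (hz : b.coord 0 z < 1) {U : Set E} (hU : U ∈ 𝓝 z) :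
    ∃ x ∈ U, b.coord 0 x < b.coord 0 z ∧
      ∃ t > 0, b.coord 1 x = t * b.coord 1 z ∧ b.coord 2 x = t * b.coord 2 z := by
  have htends : Tendsto (fun t : ℝ => AffineMap.lineMap (b 0) z t) (𝓝[>] 1) (𝓝 z) := by
    have hcont : Continuous fun t : ℝ => AffineMap.lineMap (b 0) z t := by fun_prop
    simpa using (hcont.tendsto 1).mono_left nhdsWithin_le_nhds
  obtain ⟨t, htU, ht⟩ := ((htends.eventually_mem hU).and self_mem_nhdsWithin).exists
  have hcoord (i) : b.coord i (AffineMap.lineMap (b 0) z t) =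
      (1 - t) * b.coord i (b 0) + t * b.coord i z := by
    rw [AffineMap.apply_lineMap, AffineMap.lineMap_apply_ring]
  refine ⟨_, htU, ?_, t, one_pos.trans ht, ?_, ?_⟩
  · rw [hcoord, b.coord_apply_eq]
    nlinarith
  · simp [hcoord]
  · simp [hcoord]

end Pencil

namespace WeightedComplex

variable {Z : WeightedComplex 2}

-- Rotate a line about the vertex `b 0` until it first meets the support inside the triangle. It
-- touches the support there, so the support continues along it beyond the farthest contact point.
theorem Balanced.disjoint_convexHull_support (hZ : Z.Balanced)
    (b : AffineBasis (Fin 3) ℝ (Space 2))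
    (h₀ : ∀ x ∈ convexHull ℝ (range b) ∩ Z.support, 0 < b.coord 0 x)
    (h₂ : ∀ x ∈ convexHull ℝ (range b) ∩ Z.support, 0 < b.coord 2 x) :
    Disjoint (convexHull ℝ (range b)) Z.support := by
  rw [disjoint_iff_inter_eq_empty, ← not_nonempty_iff_eq_empty]
  intro hne
  set K := convexHull ℝ (range b) ∩ Z.support
  have hK : IsCompact K :=
    (finite_range b).isCompact_convexHull (𝕜 := ℝ) |>.inter_right Z.isClosed_support
  have hmem {x} : x ∈ K ↔ (∀ i, 0 ≤ b.coord i x) ∧ x ∈ Z.support := by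
    rw [mem_inter_iff, b.convexHull_eq_nonneg_coord, mem_ofPred_eq]
  obtain ⟨a, ⟨ha₀, ha₁⟩, z, hz, hza, hmin, hmin'⟩ :=
    exists_isMinOn_pencil b hK hne (fun x hx => (hmem.1 hx).1 1) h₂
  set f : Space 2 →ᵃ[ℝ] ℝ := (1 - a) • b.coord 2 - a • b.coord 1
  have hfx (x) : f x = (1 - a) * b.coord 2 x - a * b.coord 1 x := rfl
  have hlocal : ∀ᶠ x in 𝓝 z, 0 < b.coord 0 x ∧ 0 < b.coord 2 x :=
    ((continuous_coord b 0).continuousAt.eventually_const_lt (h₀ z hz)).and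
      ((continuous_coord b 2).continuousAt.eventually_const_lt (h₂ z hz))
  have hf_min : IsLocalMinOn f Z.support z := by
    refine eventually_nhdsWithin_iff.2 (hlocal.mono fun x hx hxZ => ?_)
    rw [hfx, hza, sub_self, hfx, sub_nonneg]
    rcases le_total 0 (b.coord 1 x) with h | h
    · exact hmin x (hmem.2 ⟨Fin.forall_fin_succ.2 (by simpa using ⟨hx.1.le, h, hx.2.le⟩), hxZ⟩)
    · exact (mul_nonpos_of_nonneg_of_nonpos ha₀ h).trans
        (mul_nonneg (sub_nonneg.2 ha₁) hx.2.le)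
  have hz₁ : b.coord 0 z < 1 := by
    have hsum := coord_add_coord_add_coord b 0 z
    simp only [zero_add] at hsum
    linarith [h₂ z hz, (hmem.1 hz).1 1]
  obtain ⟨x, ⟨⟨hx₀, hx₂⟩, hxZ⟩, hlt, t, ht, ht₁, ht₂⟩ := exists_coord_lt_of_mem_nhds b hz₁
    (hlocal.and (hZ.eventually_mem_support_of_isLocalMinOn hz.2 (linear_pencil_ne_zero b a) hf_min))
  have hxa : (1 - a) * b.coord 2 x = a * b.coord 1 x := by
    rw [ht₁, ht₂]
    linear_combination t * hza
  have hx₁ : 0 ≤ b.coord 1 x := ht₁ ▸ mul_nonneg ht.le ((hmem.1 hz).1 1)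
  have hfxz : f x = f z := by rw [hfx, hfx, hxa, hza, sub_self, sub_self]
  refine hlt.not_ge (hmin' x (hmem.2 ⟨?_, hxZ hfxz⟩) hxa)
  exact Fin.forall_fin_succ.2 (by simpa using ⟨hx₀.le, hx₁, hx₂.le⟩)

theorem Balanced.convexHull_subset_compl_support (hZ : Z.Balanced)
    (b : AffineBasis (Fin 3) ℝ (Space 2)) (h₀₁ : segment ℝ (b 0) (b 1) ⊆ Z.supportᶜ)
    (h₁₂ : segment ℝ (b 1) (b 2) ⊆ Z.supportᶜ) : convexHull ℝ (range b) ⊆ Z.supportᶜ := by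
  have hnonneg {x} (hx : x ∈ convexHull ℝ (range b)) : ∀ i, 0 ≤ b.coord i x := by
    rwa [b.convexHull_eq_nonneg_coord] at hx
  refine subset_compl_iff_disjoint_right.2 (hZ.disjoint_convexHull_support b ?_ ?_)
  · refine fun x hx => (hnonneg hx.1 0).lt_of_ne' fun h => h₁₂ ?_ hx.2
    simpa using mem_segment_of_coord_eq_zero b h (hnonneg hx.1 _) (hnonneg hx.1 _)
  · refine fun x hx => (hnonneg hx.1 2).lt_of_ne' fun h => h₀₁ ?_ hx.2
    simpa using mem_segment_of_coord_eq_zero b h (hnonneg hx.1 _) (hnonneg hx.1 _)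

theorem Balanced.segment_subset_trans (hZ : Z.Balanced) {p q r : Space 2}
    (hpq : segment ℝ p q ⊆ Z.supportᶜ) (hqr : segment ℝ q r ⊆ Z.supportᶜ) :
    segment ℝ p r ⊆ Z.supportᶜ := by
  by_cases hcol : Collinear ℝ {p, q, r}
  · exact (segment_subset_union_of_collinear hcol).trans (union_subset hpq hqr)
  have hind : AffineIndependent ℝ ![p, q, r] := affineIndependent_iff_not_collinear_set.2 hcol
  let b : AffineBasis (Fin 3) ℝ (Space 2) :=
    ⟨![p, q, r], hind, hind.affineSpan_eq_top_iff_card_eq_finrank_add_one.2 (by simp)⟩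
  exact (segment_subset_convexHull (mem_range_self (f := b) 0) (mem_range_self (f := b) 2)).trans
    (hZ.convexHull_subset_compl_support b hpq hqr)

theorem Balanced.segment_subset_of_mem_connectedComponentIn (hZ : Z.Balanced) {p q : Space 2}
    (hq : q ∈ connectedComponentIn Z.supportᶜ p) : segment ℝ p q ⊆ Z.supportᶜ := by
  have hp : p ∈ connectedComponentIn Z.supportᶜ p :=
    mem_connectedComponentIn (connectedComponentIn_nonempty_iff.1 ⟨q, hq⟩)
  refine isPreconnected_connectedComponentIn.induction₂ (fun p q => segment ℝ p q ⊆ Z.supportᶜ)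
    (fun y hy => ?_) (fun _ _ _ _ _ _ => hZ.segment_subset_trans)
    (fun _ _ _ _ h => by rwa [segment_symm]) hp hq
  obtain ⟨ε, hε, hball⟩ := Metric.isOpen_iff.1 Z.isClosed_support.isOpen_compl y
    (connectedComponentIn_subset _ _ hy)
  filter_upwards [nhdsWithin_le_nhds (Metric.ball_mem_nhds y hε)] with w hw
  exact ((convex_ball y ε).segment_subset (Metric.mem_ball_self hε) hw).trans hball

theorem Balanced.card_le_mlen {ι : Type*} (hZ : Z.Balanced) {x : ι → Space 2}
    (hx : ∀ i, x i ∉ Z.support) (h : Pairwise fun i j => ¬ segment ℝ (x i) (x j) ⊆ Z.supportᶜ) :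
    ENat.card ι ≤ Z.mlen :=
  card_le_card_connectedComponents hx fun _ _ hij hmem =>
    h hij (hZ.segment_subset_of_mem_connectedComponentIn hmem)

end WeightedComplex

section LineGerm

variable {K : Set (Space 2)} {f : Space 2 →ᵃ[ℝ] ℝ} {b y : Space 2}

/-- Near its point `b`, the line `f = 0` is contained in `K`. The affine function `f` rather than
the line is recorded because it also singles out one side of the line. -/
structure ContainsLineGerm (K : Set (Space 2)) (f : Space 2 →ᵃ[ℝ] ℝ) (b : Space 2) : Prop where
  linear_ne_zero : f.linear ≠ 0
  apply_eq_zero : f b = 0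
  eventually_mem : ∀ᶠ x in 𝓝 b, f x = 0 → x ∈ K

theorem ContainsLineGerm.neg (h : ContainsLineGerm K f b) : ContainsLineGerm K (-f) b where
  linear_ne_zero := neg_ne_zero.2 h.linear_ne_zero
  apply_eq_zero := by simp [h.apply_eq_zero]
  eventually_mem := by simpa using h.eventually_mem

theorem ContainsLineGerm.eventually_nhds_prod (h : ContainsLineGerm K f b) (hy : f y < 0) :
    ∀ᶠ p : Space 2 × Space 2 in 𝓝 (b, y), 0 < f p.1 → ¬ segment ℝ p.1 p.2 ⊆ Kᶜ := by
  have hf : Continuous f := f.continuous_of_finiteDimensional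
  set s : Space 2 × Space 2 → ℝ := fun p => f p.1 / (f p.1 - f p.2)
  have hs : ContinuousAt s (b, y) :=
    ContinuousAt.div (by fun_prop) (by fun_prop) (by simp [h.apply_eq_zero, hy.ne])
  have hcross : Tendsto (fun p => AffineMap.lineMap p.1 p.2 (s p)) (𝓝 (b, y)) (𝓝 b) := by
    have : ContinuousAt (fun p => AffineMap.lineMap p.1 p.2 (s p)) (b, y) := by fun_prop
    simpa [ContinuousAt, s, h.apply_eq_zero] using this
  have hneg : ∀ᶠ p : Space 2 × Space 2 in 𝓝 (b, y), f p.2 < 0 :=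
    (hf.comp continuous_snd).continuousAt.eventually_lt_const hy
  filter_upwards [hcross.eventually h.eventually_mem, hneg] with p hp hp₂ hp₁ hsub
  refine hsub ?_ (hp ?_)
  · rw [segment_eq_image_lineMap]
    refine mem_image_of_mem _ ⟨div_nonneg hp₁.le (by linarith), div_le_one_of_le₀ ?_ ?_⟩
    all_goals linarith
  · rw [AffineMap.apply_lineMap, AffineMap.lineMap_apply_ring]
    have : f p.1 - f p.2 ≠ 0 := by linarith
    simp only [s]
    field_simp
    ring

theorem ContainsLineGerm.eventually_nhds (h : ContainsLineGerm K f b) (hy : f y < 0) :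
    ∀ᶠ x in 𝓝 b, 0 < f x → ¬ segment ℝ x y ⊆ Kᶜ :=
  (h.eventually_nhds_prod hy).curry_nhds.mono fun _ hx => hx.self_of_nhds

end LineGerm

namespace WeightedComplex

theorem neBot_nhdsWithin_pos_inter_compl_support {d : ℕ} {Z : WeightedComplex d}
    {f : Space d →ᵃ[ℝ] ℝ} {b : Space d} (hf : f.linear ≠ 0) (hb : f b = 0) :
    (𝓝[{x | 0 < f x} ∩ Z.supportᶜ] b).NeBot := by
  have hopen : IsOpen {x | 0 < f x} :=
    isOpen_lt continuous_const f.continuous_of_finiteDimensional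
  have hsub := Z.dense_compl_support.open_subset_closure_inter hopen
  exact mem_closure_iff_nhdsWithin_neBot.1
    (closure_minimal hsub isClosed_closure (mem_closure_pos hf hb))

variable {Z : WeightedComplex 2} {f : Space 2 →ᵃ[ℝ] ℝ} {b e : Space 2}

theorem Balanced.card_le_mlen_of_containsLineGerm {ι : Type*} [Finite ι] (hZ : Z.Balanced)
    {f : ι → Space 2 →ᵃ[ℝ] ℝ} {b : ι → Space 2}
    (h : ∀ i, ContainsLineGerm Z.support (f i) (b i))
    (hsep : Pairwise fun i j => f i (b j) < 0 ∨ f j (b i) < 0 ∨ f j = -f i) :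
    ENat.card ι ≤ Z.mlen := by
  set A : ι → Set (Space 2) := fun i => {x | 0 < f i x} ∩ Z.supportᶜ
  have : ∀ i, (𝓝[A i] b i).NeBot := fun i =>
    neBot_nhdsWithin_pos_inter_compl_support (h i).linear_ne_zero (h i).apply_eq_zero
  have hpos (i) : ∀ᶠ x in 𝓝[A i] b i, 0 < f i x :=
    eventually_mem_nhdsWithin.mono fun _ hx => hx.1
  have hev : Pairwise fun i j => ∀ᶠ y in 𝓝[A j] b j, ∀ᶠ x in 𝓝[A i] b i,
      ¬ segment ℝ x y ⊆ Z.supportᶜ := by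
    intro i j hij
    rcases hsep hij with hlt | hlt | heq
    · have hswap := (continuous_swap.tendsto (b j, b i)).eventually
        ((h i).eventually_nhds_prod hlt)
      filter_upwards [nhdsWithin_le_nhds hswap.curry_nhds] with y hy
      filter_upwards [hpos i, nhdsWithin_le_nhds hy] with x hx hxy using hxy hx
    · filter_upwards [hpos j, nhdsWithin_le_nhds
        (((h j).eventually_nhds_prod hlt).curry_nhds)] with y hy hxy
      filter_upwards [nhdsWithin_le_nhds hxy] with x hx
      rw [segment_symm]
      exact hx hy
    · filter_upwards [hpos j] with y hy
      have hfy : f i y < 0 := by simpa [heq] using hy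
      filter_upwards [hpos i, nhdsWithin_le_nhds ((h i).eventually_nhds hfy)] with x hx hxy
        using hxy hx
  obtain ⟨x, hxA, hx⟩ := exists_pairwise_of_eventually
    (fun x y => by rw [segment_symm]; exact id) (fun i => self_mem_nhdsWithin) hev
  exact hZ.card_le_mlen (fun i => (hxA i).2) hx

theorem Balanced.two_le_mlen (hZ : Z.Balanced) (h : ContainsLineGerm Z.support f b) :
    2 ≤ Z.mlen := by
  have := hZ.card_le_mlen_of_containsLineGerm (f := ![f, -f]) (b := ![b, b])
    (Fin.forall_fin_two.2 ⟨h, h.neg⟩) fun i j hij => by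
      fin_cases i <;> fin_cases j <;> simp at hij ⊢
  simpa using this

theorem Balanced.eventually_not_segment_subset (hZ : Z.Balanced)
    (h : ContainsLineGerm Z.support f b) (he : f e = 0) (heZ : e ∉ Z.support) :
    ∀ᶠ x in 𝓝 b, 0 < f x → ¬ segment ℝ x e ⊆ Z.supportᶜ := by
  obtain ⟨ε, hε, hball⟩ := Metric.isOpen_iff.1 Z.isClosed_support.isOpen_compl e heZ
  obtain ⟨y, hfy, hy⟩ : ∃ y, f y < 0 ∧ y ∈ Metric.ball e ε := by
    have := mem_closure_pos (f := -f) (z := e) (neg_ne_zero.2 h.linear_ne_zero) (by simp [he])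
    simpa using mem_closure_iff_nhds'.1 this _ (Metric.ball_mem_nhds e hε)
  have hey : segment ℝ e y ⊆ Z.supportᶜ :=
    ((convex_ball e ε).segment_subset (Metric.mem_ball_self hε) hy).trans hball
  exact (h.eventually_nhds hfy).mono fun x hx hfx hxe => hx hfx (hZ.segment_subset_trans hxe hey)

theorem Balanced.three_le_mlen (hZ : Z.Balanced) (h : ContainsLineGerm Z.support f b)
    (he : f e = 0) (heZ : e ∉ Z.support) : 3 ≤ Z.mlen := by
  have hside {g : Space 2 →ᵃ[ℝ] ℝ} (hg : ContainsLineGerm Z.support g b) (hge : g e = 0)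
      {p : Space 2 → Prop} (hp : ∀ᶠ x in 𝓝 b, 0 < g x → p x) :
      ∃ x ∉ Z.support, 0 < g x ∧ p x ∧ ¬ segment ℝ x e ⊆ Z.supportᶜ := by
    have := neBot_nhdsWithin_pos_inter_compl_support (Z := Z) hg.linear_ne_zero hg.apply_eq_zero
    obtain ⟨x, ⟨hxp, hxe⟩, hx⟩ :=
      (((hp.and (hZ.eventually_not_segment_subset hg hge heZ)).filter_mono nhdsWithin_le_nhds).and
        (self_mem_nhdsWithin (s := {x | 0 < g x} ∩ Z.supportᶜ))).exists
    exact ⟨x, hx.2, hx.1, hxp hx.1, hxe hx.1⟩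
  obtain ⟨y, hyZ, hfy, -, hye⟩ := hside h.neg (by simp [he]) (p := fun _ => True) (by simp)
  obtain ⟨x, hxZ, -, hxy, hxe⟩ := hside h he (h.eventually_nhds (y := y) (by simpa using hfy))
  have := hZ.card_le_mlen (x := ![x, y, e]) (by simp [Fin.forall_fin_succ, hxZ, hyZ, heZ])
    fun i j hij => by
      fin_cases i <;> fin_cases j <;> simp_all [segment_symm ℝ]
  simpa using this

end WeightedComplex

theorem exists_containsLineGerm {K : Set (Space 2)} {f : Space 2 →ᵃ[ℝ] ℝ} {a v : Space 2}
    (hf : f.linear ≠ 0) (hfa : f a = 0) (hv0 : v ≠ 0) (hfv : f.linear v = 0)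
    (h : ∀ᶠ t : ℝ in atTop, a + t • v ∈ K) : ∃ t > (0 : ℝ), ContainsLineGerm K f (a + t • v) := by
  obtain ⟨T, hT⟩ := eventually_atTop.1 h
  have hfb : f (a + (max T 0 + 1) • v) = 0 := by simp [apply_add_smul, hfa, hfv]
  refine ⟨max T 0 + 1, by positivity, hf, hfb, ?_⟩
  have hline : ∀ᶠ s : ℝ in 𝓝 0, a + (max T 0 + 1) • v + s • v ∈ K := by
    filter_upwards [eventually_gt_nhds (neg_lt_zero.2 one_pos)] with s hs
    rw [add_assoc, ← add_smul]
    exact hT _ (by linarith [le_max_left T 0])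
  simpa only [hfb] using eventually_mem_of_eventually_add_smul_mem hf hv0 hfv hline

namespace WeightedComplex

theorem finite_skeleton (Z : WeightedComplex 2) : Z.skeleton.Finite := by
  have hunion : Z.skeleton = ⋃ τ ∈ {τ ∈ (Z.cells : Set (Set (Space 2))) | dim τ = 0}, τ := by
    ext x
    simp [skeleton, and_assoc]
  rw [hunion]
  refine (Z.cells.finite_toSet.sep _).biUnion fun τ hτ => ?_
  exact ((vectorSpan_eq_bot_iff_subsingleton ℝ).1 (Submodule.finrank_eq_zero.1 hτ.2)).finite

theorem support_subset_of_diff_subset {Z : WeightedComplex 2} {B K : Set (Space 2)}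
    (hB : B.Finite) (hK : IsClosed K) (h : Z.support \ B ⊆ K) : Z.support ⊆ K := by
  rintro x ⟨σ, hσ, hx⟩
  have hacc : AccPt x (𝓟 σ) :=
    (isPolyhedron_of_mem_facets hσ).convex.isPreconnected.preperfect_of_nontrivial
      (nontrivial_of_dim_eq_one (dim_eq_one_of_mem_facets hσ)) x hx
  have hoff : ∀ᶠ y in 𝓝[≠] x, y ∉ B := nhdsNE_le_cofinite x hB.compl_mem_cofinite
  rw [← hK.closure_eq, mem_closure_iff_frequently]
  exact ((accPt_iff_frequently_nhdsNE.1 hacc).and_eventually hoff).filter_mono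
    nhdsWithin_le_nhds |>.mono fun y hy => h ⟨⟨σ, hσ, hy.1⟩, hy.2⟩

theorem WeightLE.support_subset {X Y : WeightedComplex 2} (h : X.WeightLE Y) :
    X.support ⊆ Y.support := by
  refine support_subset_of_diff_subset (X.finite_skeleton.union Y.finite_skeleton)
    Y.isClosed_support fun x ⟨hx, hoff⟩ => ?_
  rw [mem_union, not_or] at hoff
  exact Y.weightAt_pos_iff.1 ((X.weightAt_pos_iff.2 hx).trans_le (h x hoff.1 hoff.2))

section IsSum

variable {Y : WeightedComplex 2} {n : ℕ} {Z : Fin n → WeightedComplex 2}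

theorem IsSum.support_diff_eq (hY : Y.IsSum Z) :
    ∃ B : Set (Space 2), B.Finite ∧ Y.support \ B = (⋃ i, (Z i).support) \ B := by
  refine ⟨Y.skeleton ∪ ⋃ i, (Z i).skeleton,
    Y.finite_skeleton.union (finite_iUnion fun i => (Z i).finite_skeleton), ?_⟩
  ext x
  simp only [Set.mem_sdiff, mem_union, mem_iUnion, not_or, not_exists]
  refine and_congr_left fun ⟨hx, hxZ⟩ => ?_
  rw [← weightAt_pos_iff, hY x hx hxZ,
    Finset.sum_pos_iff_of_nonneg fun i _ => (Z i).weightAt_nonneg x]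
  simp [weightAt_pos_iff]

theorem IsSum.support_subset (hY : Y.IsSum Z) (i : Fin n) : (Z i).support ⊆ Y.support := by
  obtain ⟨B, hB, hBeq⟩ := hY.support_diff_eq
  exact support_subset_of_diff_subset hB Y.isClosed_support fun x hx =>
    (hBeq.superset ⟨mem_iUnion_of_mem i hx.1, hx.2⟩).1

theorem IsSum.support_subset_iUnion (hY : Y.IsSum Z) : Y.support ⊆ ⋃ i, (Z i).support := by
  obtain ⟨B, hB, hBeq⟩ := hY.support_diff_eq
  exact support_subset_of_diff_subset hB (isClosed_iUnion_of_finite fun i => (Z i).isClosed_support)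
    fun x hx => (hBeq.subset hx).1

theorem IsSum.exists_eventually_mem_support (hY : Y.IsSum Z) {a v : Space 2}
    (h : ∀ᶠ t : ℝ in atTop, a + t • v ∈ Y.support) :
    ∃ i, ∀ᶠ t : ℝ in atTop, a + t • v ∈ (Z i).support := by
  set S : Set (Set (Space 2)) := ⋃ i, (Z i).facets
  have hS : S.Finite := finite_iUnion fun i => (Z i).facets.finite_toSet
  have hconv : ∀ σ ∈ S, Convex ℝ σ := fun σ hσ =>
    let ⟨_, hi⟩ := mem_iUnion.1 hσ
    (isPolyhedron_of_mem_facets hi).convex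
  obtain ⟨σ, hσ, hev⟩ := exists_eventually_add_smul_mem hS hconv <| h.frequently.mono fun t ht =>
    let ⟨i, σ, hi, hx⟩ := mem_iUnion.1 (hY.support_subset_iUnion ht)
    ⟨σ, mem_iUnion_of_mem i hi, hx⟩
  obtain ⟨i, hi⟩ := mem_iUnion.1 hσ
  exact ⟨i, hev.mono fun t ht => ⟨σ, hi, ht⟩⟩

end IsSum

theorem exists_isSum_of_flen_le {d : ℕ} {Y : WeightedComplex d} {m : ℕ} (h : Y.flen ≤ m) :
    ∃ (n : ℕ) (Z : Fin (n + 1) → WeightedComplex d) (N : Fin (n + 1) → ℕ),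
      (∀ r, (Z r).Balanced) ∧ Y.IsSum Z ∧ (∀ r, (Z r).mlen = N r) ∧ ∑ r, N r ≤ m + n := by
  have hlt : Y.flen < (m + 1 : ℕ) := h.trans_lt (by exact_mod_cast m.lt_succ_self)
  simp only [flen, iInf_lt_iff] at hlt
  obtain ⟨n, Z, hZ, hsum, hlt⟩ := hlt
  have hlt' : ∑ r, (Z r).mlen < (m + 1 + n : ℕ) := by
    exact_mod_cast (ENat.addLECancellable_natCast n).lt_add_of_tsub_lt_right hlt
  have hfin (r) : (Z r).mlen ≠ ⊤ :=
    (ENat.sum_lt_top.1 (hlt'.trans (ENat.natCast_lt_top _)) r (Finset.mem_univ r)).ne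
  choose N hN using fun r => ENat.ne_top_iff_exists.1 (hfin r)
  refine ⟨n, Z, N, hZ, hsum, fun r => (hN r).symm, ?_⟩
  simp only [← hN] at hlt'
  have : ∑ r, N r < m + 1 + n := by exact_mod_cast hlt'
  omega

theorem one_le_mlen {d : ℕ} (Z : WeightedComplex d) : 1 ≤ Z.mlen := by
  obtain ⟨x, hx⟩ := Z.dense_compl_support.nonempty
  exact ENat.one_le_card_iff_nonempty _ |>.2 ⟨((⟨x, hx⟩ : ↥(Z.support)ᶜ) : ConnectedComponents _)⟩

section SeparatedRays

variable {ι : Type*} [Finite ι] {f : ι → Space 2 →ᵃ[ℝ] ℝ}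

theorem Balanced.card_add_two_le {Z : WeightedComplex 2} (hZ : Z.Balanced) {b : ι → Space 2}
    (h : ∀ i, ContainsLineGerm Z.support (f i) (b i))
    (hsep : Pairwise fun i j => f i (b j) < 0 ∨ f j (b i) < 0 ∨ f j = -f i) {N : ℕ}
    (hN : Z.mlen = N) : Nat.card ι + 2 ≤ 2 * N := by
  have hcard := hZ.card_le_mlen_of_containsLineGerm h hsep
  rw [hN, ENat.card_eq_coe_natCard, Nat.cast_le] at hcard
  rcases isEmpty_or_nonempty ι with hι | ⟨⟨i⟩⟩
  · have := hN ▸ Z.one_le_mlen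
    rw [Nat.card_of_isEmpty]
    have : 1 ≤ N := by exact_mod_cast this
    omega
  · have := hN ▸ hZ.two_le_mlen (h i)
    have : 2 ≤ N := by exact_mod_cast this
    omega

theorem Balanced.card_add_two_lt {Z : WeightedComplex 2} (hZ : Z.Balanced) {b : ι → Space 2}
    (h : ∀ i, ContainsLineGerm Z.support (f i) (b i))
    (hsep : Pairwise fun i j => f i (b j) < 0 ∨ f j (b i) < 0 ∨ f j = -f i) {N : ℕ}
    (hN : Z.mlen = N) {i : ι} {e : Space 2} (he : f i e = 0) (heZ : e ∉ Z.support) :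
    Nat.card ι + 2 < 2 * N := by
  have hcard := hZ.card_le_mlen_of_containsLineGerm h hsep
  have hthree := hZ.three_le_mlen (h i) he heZ
  rw [hN, ENat.card_eq_coe_natCard, Nat.cast_le] at hcard
  rw [hN] at hthree
  have : 3 ≤ N := by exact_mod_cast hthree
  omega

theorem mem_support_of_flen_le {Y : WeightedComplex 2} {m : ℕ} (hflen : Y.flen ≤ m)
    (hm : 2 * m ≤ Nat.card ι + 2) {a v : ι → Space 2} (hf : ∀ i, (f i).linear ≠ 0)
    (hfa : ∀ i, f i (a i) = 0) (hv : ∀ i, v i ≠ 0) (hfv : ∀ i, (f i).linear (v i) = 0)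
    (hray : ∀ i, ∀ᶠ t : ℝ in atTop, a i + t • v i ∈ Y.support)
    (hsep : Pairwise fun i j => f j = -f i ∨
      (∀ t > (0 : ℝ), f i (a j + t • v j) < 0) ∨ ∀ t > (0 : ℝ), f j (a i + t • v i) < 0)
    {i : ι} {x : Space 2} (hx : f i x = 0) : x ∈ Y.support := by
  obtain ⟨n, Z, N, hZ, hsum, hN, hle⟩ := exists_isSum_of_flen_le hflen
  choose r hr using fun i => hsum.exists_eventually_mem_support (hray i)
  choose t ht hgerm using fun i => exists_containsLineGerm (hf i) (hfa i) (hv i) (hfv i) (hr i)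
  have hgerm' (q) (j : {j // r j = q}) :
      ContainsLineGerm (Z q).support (f j) (a j + t j • v j) := by
    obtain ⟨j, rfl⟩ := j
    exact hgerm j
  have hsep' (q) : Pairwise fun j k : {j // r j = q} => f j (a k + t k • v k) < 0 ∨
      f k (a j + t j • v j) < 0 ∨ f k = -f j := fun j k hjk => by
    exact (hsep (Subtype.coe_ne_coe.2 hjk)).elim (fun h => .inr (.inr h))
      (Or.imp (fun h => h _ (ht k)) fun h => .inl (h _ (ht j)))
  by_contra hxY
  have hlt : ∑ q, (Nat.card {j // r j = q} + 2) < ∑ q, 2 * N q :=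
    Finset.sum_lt_sum (fun q _ => (hZ q).card_add_two_le (hgerm' q) (hsep' q) (hN q))
      ⟨r i, Finset.mem_univ _, (hZ _).card_add_two_lt (hgerm' _) (hsep' _) (hN _) (i := ⟨i, rfl⟩)
        hx fun h => hxY (hsum.support_subset _ h)⟩
  have hcard : ∑ q, Nat.card {j // r j = q} = Nat.card ι := by
    rw [← Nat.card_sigma, Nat.card_congr (Equiv.sigmaFiberEquiv r)]
  rw [Finset.sum_add_distrib, hcard, Finset.sum_const, Finset.card_fin, smul_eq_mul,
    ← Finset.mul_sum] at hlt
  omega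

end SeparatedRays

end WeightedComplex

theorem notMem_connectedComponentIn_of_neg_of_pos {X : Type*} [TopologicalSpace X] {F : Set X}
    {f : X → ℝ} (hf : Continuous f) (hF : ∀ z ∈ F, f z ≠ 0) {x y : X} (hx : f x < 0)
    (hy : 0 < f y) : y ∉ connectedComponentIn F x := fun hmem => by
  have hxF : x ∈ connectedComponentIn F x :=
    mem_connectedComponentIn (connectedComponentIn_nonempty_iff.1 ⟨y, hmem⟩)
  obtain ⟨z, hz, hfz⟩ := isPreconnected_connectedComponentIn.intermediate_value hxF hmem
    hf.continuousOn ⟨hx.le, hy.le⟩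
  exact hF z (connectedComponentIn_subset F x hz) hfz

section SignVector

variable {ι E : Type*} [Finite ι] [AddCommGroup E] [Module ℝ E] (b : AffineBasis ι ℝ E)

theorem exists_coord_pos_and_coord_neg {P : Finset ι} (hP : P.Nonempty) :
    ∃ x, (∀ i ∈ P, 0 < b.coord i x) ∧ ∀ i ∉ P, b.coord i x < 0 := by
  classical
  have := Fintype.ofFinite ι
  set w : ι → ℝ := fun i => if i ∈ P then (1 + (Pᶜ.card : ℝ)) / P.card else -1
  have hcard : (0 : ℝ) < P.card := by exact_mod_cast hP.card_pos
  have hw : ∑ i, w i = 1 := by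
    rw [← Finset.sum_add_sum_compl P, Finset.sum_congr rfl fun i hi => if_pos hi,
      Finset.sum_congr rfl fun i hi => if_neg (Finset.mem_compl.1 hi)]
    simp only [Finset.sum_const, nsmul_eq_mul]
    rw [mul_div_cancel₀ _ hcard.ne']
    ring
  refine ⟨Finset.univ.affineCombination ℝ b w, fun i hi => ?_, fun i hi => ?_⟩ <;>
    rw [b.coord_apply_combination_of_mem (Finset.mem_univ i) hw]
  · simp only [w, if_pos hi]
    exact div_pos (by positivity) hcard
  · simp [w, hi]

end SignVector

theorem WeightedComplex.two_pow_sub_one_le_mlen {d : ℕ} {ι : Type*} [Fintype ι]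
    (b : AffineBasis ι ℝ (Space d)) {Z : WeightedComplex d}
    (hZ : ∀ i x, b.coord i x = 0 → x ∈ Z.support) :
    (2 ^ Fintype.card ι - 1 : ℕ) ≤ Z.mlen := by
  classical
  have hcont (i) : Continuous (b.coord i) := (b.coord i).continuous_of_finiteDimensional
  have hex (P : {P : Finset ι // P.Nonempty}) : ∃ x ∉ Z.support,
      (∀ i ∈ P.1, 0 < b.coord i x) ∧ ∀ i ∉ P.1, b.coord i x < 0 := by
    have hopen : IsOpen {x | (∀ i ∈ P.1, 0 < b.coord i x) ∧ ∀ i ∉ P.1, b.coord i x < 0} := by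
      simp only [ofPred_and, ofPred_forall]
      exact (isOpen_iInter_of_finite fun i => isOpen_iInter_of_finite fun _ =>
        isOpen_lt continuous_const (hcont i)).inter (isOpen_iInter_of_finite fun i =>
          isOpen_iInter_of_finite fun _ => isOpen_lt (hcont i) continuous_const)
    obtain ⟨x, hx, hxZ⟩ := Z.dense_compl_support.inter_open_nonempty _ hopen
      (exists_coord_pos_and_coord_neg b P.2)
    exact ⟨x, hxZ, hx⟩
  choose x hxZ hpos hneg using hex
  have hcard : Fintype.card {P : Finset ι // P.Nonempty} = 2 ^ Fintype.card ι - 1 := by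
    simp_rw [Finset.nonempty_iff_ne_empty, ne_eq]
    rw [Fintype.card_subtype_compl, Fintype.card_finset, Fintype.card_subtype_eq]
  rw [← hcard, ← ENat.card_eq_coe_fintype_card]
  refine card_le_card_connectedComponents (F := Z.supportᶜ) hxZ fun P Q hPQ => ?_
  obtain ⟨i, ⟨hP, hQ⟩ | ⟨hQ, hP⟩⟩ : ∃ i, (i ∈ P.1 ∧ i ∉ Q.1) ∨ (i ∈ Q.1 ∧ i ∉ P.1) := by
    by_contra! h
    exact hPQ (Subtype.ext (Finset.Subset.antisymm (fun i => (h i).1) fun i => (h i).2))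
  · refine notMem_connectedComponentIn_of_neg_of_pos (hcont i).neg (fun z hz h => ?_)
      (neg_neg_iff_pos.2 (hpos P i hP)) (neg_pos.2 (hneg Q i hQ))
    exact hz (hZ i z (neg_eq_zero.1 h))
  · refine notMem_connectedComponentIn_of_neg_of_pos (hcont i) (fun z hz h => ?_)
      (hneg P i hP) (hpos Q i hQ)
    exact hz (hZ i z h)

section Polyhedron

variable {d : ℕ}

theorem isPolyhedron_setOf_le (l : StrongDual ℝ (Space d)) (c : ℝ) :
    IsPolyhedron {x | l x ≤ c} :=
  ⟨1, fun _ => (InnerProductSpace.toDual ℝ _).symm l, fun _ => c, by simp⟩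

theorem isPolyhedron_iInter {ι : Type*} [Finite ι] {P : ι → Set (Space d)}
    (h : ∀ i, IsPolyhedron (P i)) : IsPolyhedron (⋂ i, P i) := by
  choose k a b hP using h
  obtain ⟨n, ⟨e⟩⟩ := Finite.exists_equiv_fin (Σ i, Fin (k i))
  refine ⟨n, fun j => a _ (e.symm j).2, fun j => b _ (e.symm j).2, ?_⟩
  ext x
  rw [mem_iInter, mem_ofPred_eq,
    e.symm.forall_congr_right (q := fun j => ⟪a j.1 j.2, x⟫_ℝ ≤ b j.1 j.2), Sigma.forall]
  simp only [hP, mem_ofPred_eq]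

theorem IsPolyhedron.inter {P Q : Set (Space d)} (hP : IsPolyhedron P) (hQ : IsPolyhedron Q) :
    IsPolyhedron (P ∩ Q) := by
  rw [inter_eq_iInter]
  exact isPolyhedron_iInter (Bool.forall_bool.2 ⟨hQ, hP⟩)

theorem isPolyhedron_setOf_eq (l : StrongDual ℝ (Space d)) (c : ℝ) :
    IsPolyhedron {x | l x = c} := by
  have := (isPolyhedron_setOf_le l c).inter (isPolyhedron_setOf_le (-l) (-c))
  convert this using 1
  ext x
  simp [le_antisymm_iff]

theorem isPolyhedron_singleton (q : Space d) : IsPolyhedron {q} := by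
  have := isPolyhedron_iInter fun i => isPolyhedron_setOf_eq (EuclideanSpace.proj i) (q i)
  convert this using 1
  ext x
  simp [PiLp.ext_iff]

end Polyhedron

/-- A segment or a ray with a distinguished initial point, traversed with velocity `dir` for the
time `length`; it is a ray if `length = ⊤`. In a complex it gets the weight `‖dir‖`, so that
balancing means that the velocities sum to zero. -/
structure Edge (d : ℕ) where
  base : Space d
  dir : Space d
  length : WithTop ℝ
  dir_ne_zero : dir ≠ 0
  length_pos : 0 < length

namespace Edge

variable {d : ℕ} (e : Edge d) {q x y : Space d} {s t : ℝ}

/-- The points of an edge. -/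
def carrier : Set (Space d) :=
  {x | ∃ t : ℝ, 0 ≤ t ∧ t ≤ e.length ∧ e.base + t • e.dir = x}

/-- The endpoints of an edge: two for a segment, one for a ray. -/
def ends : Set (Space d) :=
  {x | ∃ t : ℝ, (t = 0 ∨ t = e.length) ∧ e.base + t • e.dir = x}

theorem ends_subset_carrier : e.ends ⊆ e.carrier := by
  rintro _ ⟨t, rfl | ht, rfl⟩
  · exact ⟨0, le_rfl, e.length_pos.le, rfl⟩
  · exact ⟨t, by exact_mod_cast (ht ▸ e.length_pos).le, ht.le, rfl⟩

theorem base_mem_ends : e.base ∈ e.ends :=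
  ⟨0, .inl rfl, by simp⟩

theorem finite_ends : e.ends.Finite := by
  have htimes : {t : ℝ | t = 0 ∨ t = e.length}.Finite :=
    (finite_singleton 0).union (Subsingleton.finite fun s hs t ht =>
      WithTop.coe_injective (hs.trans ht.symm))
  refine (htimes.image fun t => e.base + t • e.dir).subset ?_
  rintro x ⟨t, ht, rfl⟩
  exact mem_image_of_mem _ ht

variable {e} in
theorem exists_lt_lt_length (ht : t < e.length) : ∃ s : ℝ, t < s ∧ s < e.length := by
  obtain ⟨s, hts, hs⟩ := exists_between ht
  lift s to ℝ using hs.ne_top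
  exact ⟨s, by exact_mod_cast hts, hs⟩

theorem add_smul_dir_inj : e.base + s • e.dir = e.base + t • e.dir ↔ s = t := by
  simp [e.dir_ne_zero]

theorem not_carrier_subset_ends : ¬ e.carrier ⊆ e.ends := by
  obtain ⟨t, ht₀, ht⟩ := exists_lt_lt_length e.length_pos
  intro h
  obtain ⟨s, hs, hst⟩ := h ⟨t, ht₀.le, ht.le, rfl⟩
  obtain rfl := e.add_smul_dir_inj.1 hst
  exact hs.elim ht₀.ne' ht.ne

theorem isPolyhedron_carrier : IsPolyhedron e.carrier := by
  obtain ⟨l, hl⟩ := SeparatingDual.exists_eq_one (R := ℝ) e.dir_ne_zero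
  have hlength : IsPolyhedron {x | ((l x - l e.base : ℝ) : WithTop ℝ) ≤ e.length} := by
    cases e.length with
    | top => simpa using isPolyhedron_iInter (ι := Empty) (P := fun _ => (∅ : Set (Space d))) nofun
    | coe L => simpa only [WithTop.coe_le_coe, sub_le_iff_le_add] using isPolyhedron_setOf_le l _
  convert (isPolyhedron_iInter fun i => isPolyhedron_setOf_eq
    (EuclideanSpace.proj i - e.dir i • l) (e.base i - e.dir i * l e.base)).inter
    ((isPolyhedron_setOf_le (-l) (-l e.base)).inter hlength) using 1
  ext x
  simp only [carrier, mem_inter_iff, mem_iInter, mem_ofPred_eq, sub_apply, neg_apply, smul_apply,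
    PiLp.proj_apply, smul_eq_mul, neg_le_neg_iff]
  constructor
  · rintro ⟨t, ht₀, ht, rfl⟩
    have hlt : l (e.base + t • e.dir) = l e.base + t := by simp [hl]
    refine ⟨fun i => ?_, ?_, ?_⟩
    · simp only [hlt, PiLp.add_apply, PiLp.smul_apply, smul_eq_mul]
      ring
    · rwa [hlt, le_add_iff_nonneg_right]
    · rwa [hlt, add_sub_cancel_left]
  · rintro ⟨hx, h₀, hL⟩
    refine ⟨_, sub_nonneg.2 h₀, hL, PiLp.ext fun i => ?_⟩
    simp only [PiLp.add_apply, PiLp.smul_apply, smul_eq_mul]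
    linarith [hx i]

theorem vectorSpan_carrier : vectorSpan ℝ e.carrier = Submodule.span ℝ {e.dir} := by
  refine le_antisymm (Submodule.span_le.2 (vsub_subset_iff.2 ?_)) ?_
  · rintro _ ⟨s, -, -, rfl⟩ _ ⟨t, -, -, rfl⟩
    simp only [vsub_eq_sub, add_sub_add_left_eq_sub, ← sub_smul]
    exact Submodule.smul_mem _ _ (Submodule.mem_span_singleton_self _)
  · obtain ⟨t, ht₀, ht⟩ := exists_lt_lt_length e.length_pos
    have hmem : e.base + t • e.dir ∈ e.carrier := ⟨t, ht₀.le, ht.le, rfl⟩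
    have hsmul := vsub_mem_vectorSpan ℝ hmem (e.ends_subset_carrier e.base_mem_ends)
    rw [vsub_eq_sub, add_sub_cancel_left] at hsmul
    rw [Submodule.span_singleton_le_iff_mem]
    exact (Submodule.smul_mem_iff _ ht₀.ne').1 hsmul

theorem dim_carrier : dim e.carrier = 1 := by
  rw [dim, vectorSpan_carrier, finrank_span_singleton e.dir_ne_zero]

open scoped Classical in
/-- The velocity with which the edge leaves `q`, if `q` is an endpoint, and `0` otherwise. -/
noncomputable def outgoing (q : Space d) : Space d :=
  if q = e.base then e.dir else if q ∈ e.ends then -e.dir else 0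

theorem outgoing_eq_zero (hq : q ∉ e.ends) : e.outgoing q = 0 := by
  rw [outgoing, if_neg (by rintro rfl; exact hq e.base_mem_ends), if_neg hq]

variable {e} in
open scoped Classical in
theorem outgoing_of_length_eq_top (h : e.length = ⊤) : e.outgoing = Pi.single e.base e.dir := by
  funext q
  rw [Pi.single_apply, outgoing]
  split_ifs with hq hq'
  · rfl
  · obtain ⟨t, rfl | ht, rfl⟩ := hq'
    · simp at hq
    · simp [h] at ht
  · rfl

variable {e} in
open scoped Classical in
theorem outgoing_of_length_eq_coe (h : e.length = t) :
    e.outgoing = Pi.single e.base e.dir - Pi.single (e.base + t • e.dir) e.dir := by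
  have ht : 0 < t := by exact_mod_cast h ▸ e.length_pos
  have hends (q) : q ∈ e.ends ↔ q = e.base ∨ q = e.base + t • e.dir := by
    simp [ends, h, eq_comm, or_and_right, exists_or]
  have hne : e.base ≠ e.base + t • e.dir := by simp [ht.ne', e.dir_ne_zero]
  funext q
  rw [Pi.sub_apply, Pi.single_apply, Pi.single_apply, outgoing, hends]
  split_ifs <;> simp_all

theorem norm_outgoing (hq : q ∈ e.ends) : ‖e.outgoing q‖ = ‖e.dir‖ := by
  rw [outgoing, if_pos hq]
  split_ifs
  exacts [rfl, norm_neg _]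

theorem outgoing_mem_vectorSpan : e.outgoing q ∈ vectorSpan ℝ e.carrier := by
  have hdir := Submodule.mem_span_singleton_self (R := ℝ) e.dir
  rw [vectorSpan_carrier, outgoing]
  split_ifs
  exacts [hdir, neg_mem hdir, zero_mem _]

theorem exists_nonneg_smul_outgoing (hq : q ∈ e.ends) (hx : x ∈ e.carrier) :
    ∃ t : ℝ, 0 ≤ t ∧ t • e.outgoing q = x - q := by
  obtain ⟨t, ht₀, ht, rfl⟩ := hx
  rw [outgoing, if_pos hq]
  split_ifs with h
  · exact ⟨t, ht₀, by rw [h, add_sub_cancel_left]⟩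
  · obtain ⟨s, rfl | hs, rfl⟩ := hq
    · simp at h
    · exact ⟨s - t, sub_nonneg.2 (by exact_mod_cast hs ▸ ht), by module⟩

theorem isExposed_singleton_of_mem_ends (hq : q ∈ e.ends) : IsExposed ℝ e.carrier {q} := by
  have hne : e.outgoing q ≠ 0 :=
    norm_ne_zero_iff.1 ((e.norm_outgoing hq).trans_ne (norm_ne_zero_iff.2 e.dir_ne_zero))
  obtain ⟨l, hl⟩ := SeparatingDual.exists_eq_one (R := ℝ) hne
  refine isExposed_singleton (e.ends_subset_carrier hq) (-l) fun y hy hyq => ?_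
  obtain ⟨t, ht, hty⟩ := e.exists_nonneg_smul_outgoing hq hy
  have hlt : l y - l q = t := by rw [← map_sub, ← hty, map_smul, hl, smul_eq_mul, mul_one]
  have ht0 : t ≠ 0 := by
    rintro rfl
    exact hyq (sub_eq_zero.1 (by simpa using hty.symm))
  have := ht.lt_of_ne' ht0
  simp only [neg_apply]
  linarith

theorem isUnitNormal (hq : q ∈ e.ends) :
    WeightedComplex.IsUnitNormal {q} e.carrier (‖e.dir‖⁻¹ • e.outgoing q) := by
  have hnorm : ‖e.dir‖ ≠ 0 := norm_ne_zero_iff.2 e.dir_ne_zero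
  refine ⟨?_, Submodule.smul_mem _ _ e.outgoing_mem_vectorSpan, ?_, ?_⟩
  · rw [norm_smul, norm_inv, norm_norm, e.norm_outgoing hq, inv_mul_cancel₀ hnorm]
  · simp
  · rintro _ rfl y hy
    obtain ⟨t, ht, hty⟩ := e.exists_nonneg_smul_outgoing hq hy
    rw [← hty, real_inner_smul_left, real_inner_smul_right]
    exact mul_nonneg (by positivity) (mul_nonneg ht real_inner_self_nonneg)

theorem eq_carrier_or_eq_singleton_of_isExposed {F : Set (Space d)} (hF : F.Nonempty)
    (h : IsExposed ℝ e.carrier F) : F = e.carrier ∨ ∃ q ∈ e.ends, F = {q} := by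
  obtain ⟨l, rfl⟩ := h hF
  have hl (t : ℝ) : l (e.base + t • e.dir) = l e.base + t * l e.dir := by simp
  rcases eq_or_ne (l e.dir) 0 with h0 | h0
  · left
    refine sep_eq_self_iff_mem_true.2 ?_
    rintro _ ⟨s, -, -, rfl⟩ _ ⟨t, -, -, rfl⟩
    rw [hl, hl, h0, mul_zero, mul_zero]
  right
  obtain ⟨q, hq⟩ := hF
  refine ⟨q, ?_, ?_⟩
  · obtain ⟨⟨t, ht₀, ht, rfl⟩, hmax⟩ := hq
    by_contra hends
    have hne : ¬ (t = 0 ∨ t = e.length) := fun h => hends ⟨t, h, rfl⟩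
    obtain ⟨s, hts, hs⟩ := exists_lt_lt_length (ht.lt_of_ne fun h => hne (.inr h))
    have hbase := hmax _ ⟨0, le_rfl, e.length_pos.le, rfl⟩
    have hbeyond := hmax _ ⟨s, (ht₀.trans_lt hts).le, hs.le, rfl⟩
    have ht_pos := ht₀.lt_of_ne fun h => hne (.inl h.symm)
    rw [hl, hl] at hbase hbeyond
    exact h0 (by nlinarith)
  · refine Subset.antisymm (fun y hy => ?_) (singleton_subset_iff.2 hq)
    have hly : l y = l q := le_antisymm (hq.2 _ hy.1) (hy.2 _ hq.1)
    obtain ⟨⟨t, -, -, rfl⟩, -⟩ := hq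
    obtain ⟨⟨s, -, -, rfl⟩, -⟩ := hy
    rw [hl, hl, add_right_inj, mul_left_inj' h0] at hly
    rw [mem_singleton_iff, hly]

end Edge

section EdgeFamily

variable {d : ℕ}

theorem isExposed_empty (P : Set (Space d)) : IsExposed ℝ P ∅ :=
  fun h => (not_nonempty_empty h).elim

theorem Edge.isExposed_inter_of_subset_ends {e : Edge d} {Q : Set (Space d)} (hQ : Convex ℝ Q)
    (h : e.carrier ∩ Q ⊆ e.ends) : IsExposed ℝ e.carrier (e.carrier ∩ Q) := by
  have hsub : (e.carrier ∩ Q).Subsingleton := by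
    by_contra hnt
    exact ((e.isPolyhedron_carrier.convex.inter hQ).isPreconnected.infinite_of_nontrivial
      (not_subsingleton_iff.1 hnt)) (e.finite_ends.subset h)
  rcases hsub.eq_empty_or_singleton with h0 | ⟨q, hq⟩
  · rw [h0]
    exact isExposed_empty _
  · rw [hq] at h ⊢
    exact e.isExposed_singleton_of_mem_ends (h rfl)

theorem isExposed_singleton_inter (q : Space d) (Q : Set (Space d)) :
    IsExposed ℝ {q} ({q} ∩ Q) := by
  by_cases hq : q ∈ Q
  · rw [inter_eq_left.2 (singleton_subset_iff.2 hq)]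
  · rw [singleton_inter_eq_empty.2 hq]
    exact isExposed_empty _

theorem dim_singleton (q : Space d) : dim {q} = 0 := by
  simp [dim]

variable {ι : Type*}

/-- Different edges of the family meet in common endpoints only. -/
def IsNonCrossing (e : ι → Edge d) : Prop :=
  Pairwise fun i j => (e i).carrier ∩ (e j).carrier ⊆ (e i).ends

/-- The edges with index in `S`, and their endpoints: the cells of `IsNonCrossing.complex`. -/
def edgeCells (e : ι → Edge d) (S : Finset ι) : Set (Set (Space d)) :=
  {P | ∃ i ∈ S, P = (e i).carrier ∨ ∃ q ∈ (e i).ends, P = {q}}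

theorem finite_edgeCells (e : ι → Edge d) (S : Finset ι) : (edgeCells e S).Finite := by
  have hS : edgeCells e S = ⋃ i ∈ S, insert (e i).carrier ((fun q => {q}) '' (e i).ends) := by
    ext P
    simp [edgeCells, eq_comm]
  rw [hS]
  exact S.finite_toSet.biUnion fun i _ => ((e i).finite_ends.image _).insert _

end EdgeFamily

namespace IsNonCrossing

variable {ι : Type*} {e : ι → Edge 2}

theorem carrier_injective (he : IsNonCrossing e) : Function.Injective fun i => (e i).carrier := by
  intro i j hij
  by_contra hne
  exact (e i).not_carrier_subset_ends fun x hx => he hne ⟨hx, hij.subset hx⟩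

theorem mem_ends (he : IsNonCrossing e) {i j : ι} {q : Space 2} (hi : q ∈ (e i).carrier)
    (hj : q ∈ (e j).ends) : q ∈ (e i).ends := by
  rcases eq_or_ne i j with rfl | hij
  exacts [hj, he hij ⟨hi, (e j).ends_subset_carrier hj⟩]

theorem isExposed_inter (he : IsNonCrossing e) {S : Finset ι} {P Q : Set (Space 2)}
    (hP : P ∈ edgeCells e S) (hQ : Q ∈ edgeCells e S) : IsExposed ℝ P (P ∩ Q) := by
  obtain ⟨i, -, rfl | ⟨q, -, rfl⟩⟩ := hP
  · obtain ⟨j, -, rfl | ⟨q, hq, rfl⟩⟩ := hQ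
    · rcases eq_or_ne i j with rfl | hij
      · rw [inter_self]
      · exact Edge.isExposed_inter_of_subset_ends (e j).isPolyhedron_carrier.convex (he hij)
    · refine Edge.isExposed_inter_of_subset_ends (convex_singleton q) ?_
      rintro _ ⟨hi, rfl⟩
      exact he.mem_ends hi hq
  · exact isExposed_singleton_inter q Q

variable (he : IsNonCrossing e) (S : Finset ι)

/-- The weighted complex whose maximal cells are the edges with index in `S`. -/
noncomputable def complex : WeightedComplex 2 where
  cells := (finite_edgeCells e S).toFinset
  nonempty_of_mem := by
    simp only [Finite.mem_toFinset]
    rintro _ ⟨i, -, rfl | ⟨q, -, rfl⟩⟩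
    exacts [⟨_, (e i).ends_subset_carrier (e i).base_mem_ends⟩, singleton_nonempty q]
  isPolyhedron_of_mem := by
    simp only [Finite.mem_toFinset]
    rintro _ ⟨i, -, rfl | ⟨q, -, rfl⟩⟩
    exacts [(e i).isPolyhedron_carrier, isPolyhedron_singleton q]
  face_mem := by
    simp only [Finite.mem_toFinset]
    rintro _ ⟨i, hi, rfl | ⟨q, hq, rfl⟩⟩ F hF hexp
    · exact ⟨i, hi, (e i).eq_carrier_or_eq_singleton_of_isExposed hF hexp⟩
    · exact ⟨i, hi, .inr ⟨q, hq, hF.subset_singleton_iff.1 hexp.subset⟩⟩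
  inter_face := by
    simp only [Finite.mem_toFinset]
    exact fun P hP Q hQ =>
      ⟨he.isExposed_inter hP hQ, inter_comm Q P ▸ he.isExposed_inter hQ hP⟩
  pure := by
    simp only [Finite.mem_toFinset]
    rintro P ⟨i, hi, hP⟩
    refine ⟨_, ⟨i, hi, .inl rfl⟩, by rw [(e i).dim_carrier], ?_⟩
    rcases hP with rfl | ⟨q, hq, rfl⟩
    exacts [Subset.rfl, singleton_subset_iff.2 ((e i).ends_subset_carrier hq)]
  weight := Function.extend (fun i => (e i).carrier) (fun i => ‖(e i).dir‖) 0
  weight_pos := by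
    simp only [Finite.mem_toFinset]
    rintro _ ⟨i, -, rfl | ⟨q, -, rfl⟩⟩ hdim
    · rw [he.carrier_injective.extend_apply]
      exact norm_pos_iff.2 (e i).dir_ne_zero
    · simp [dim_singleton] at hdim

theorem weight_complex_carrier (i : ι) : (he.complex S).weight (e i).carrier = ‖(e i).dir‖ :=
  he.carrier_injective.extend_apply (fun i => ‖(e i).dir‖) 0 i

open scoped Classical in
theorem facets_complex : (he.complex S).facets = S.image fun i => (e i).carrier := by
  ext σ
  simp only [WeightedComplex.mem_facets, complex, Finite.mem_toFinset, Finset.mem_image]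
  constructor
  · rintro ⟨⟨i, hi, rfl | ⟨q, -, rfl⟩⟩, hdim⟩
    · exact ⟨i, hi, rfl⟩
    · simp [dim_singleton] at hdim
  · rintro ⟨i, hi, rfl⟩
    exact ⟨⟨i, hi, .inl rfl⟩, by rw [(e i).dim_carrier]⟩

theorem support_complex : (he.complex S).support = ⋃ i ∈ S, (e i).carrier := by
  classical
  simp [WeightedComplex.support_eq_biUnion, facets_complex]

open scoped Classical in
theorem sum_facets_complex {M : Type*} [AddCommMonoid M] (p : Set (Space 2) → Prop)
    (f : Set (Space 2) → M) : ∑ σ ∈ (he.complex S).facets with p σ, f σ =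
      ∑ i ∈ S, if p (e i).carrier then f (e i).carrier else 0 := by
  rw [Finset.sum_filter, facets_complex, Finset.sum_image fun i _ j _ h => he.carrier_injective h]

theorem weightAt_complex (x : Space 2) :
    (he.complex S).weightAt x = ∑ i ∈ S, (e i).carrier.indicator (fun _ => ‖(e i).dir‖) x := by
  simp only [WeightedComplex.weightAt, sum_facets_complex, weight_complex_carrier, indicator]

theorem weightLE_complex {S T : Finset ι} (h : S ⊆ T) :
    (he.complex S).WeightLE (he.complex T) := by
  intro x _ _
  rw [weightAt_complex, weightAt_complex]
  exact Finset.sum_le_sum_of_subset_of_nonneg h fun i _ _ =>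
    indicator_nonneg (fun _ _ => norm_nonneg _) x

theorem isSum_complex {n : ℕ} (p : ι → Fin n) :
    (he.complex S).IsSum fun k => he.complex {i ∈ S | p i = k} := by
  intro x _ _
  simp only [weightAt_complex, Finset.sum_fiberwise]

theorem balanced_complex (h : ∑ i ∈ S, (e i).outgoing = 0) : (he.complex S).Balanced := by
  classical
  intro τ hτ hdim
  obtain ⟨j, -, rfl | ⟨q, hq, rfl⟩⟩ := (finite_edgeCells e S).mem_toFinset.1 hτ
  · simp [(e j).dim_carrier] at hdim
  have hsum := (Finset.sum_apply q S fun i => (e i).outgoing).symm.trans (congr_fun h q)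
  have hext := he.carrier_injective.extend_apply (fun i => ‖(e i).dir‖⁻¹ • (e i).outgoing q) 0
  refine ⟨Function.extend (fun i => (e i).carrier) (fun i => ‖(e i).dir‖⁻¹ • (e i).outgoing q) 0,
    fun σ hσ hqσ => ?_, (he.sum_facets_complex S _ _).trans (Eq.trans ?_ hsum)⟩
  · rw [facets_complex] at hσ
    obtain ⟨i, -, rfl⟩ := Finset.mem_image.1 hσ
    rw [hext]
    exact (e i).isUnitNormal (he.mem_ends (hqσ rfl) hq)
  · refine Finset.sum_congr rfl fun i _ => ?_
    rw [weight_complex_carrier, hext, smul_smul,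
      mul_inv_cancel₀ (norm_ne_zero_iff.2 (e i).dir_ne_zero), one_smul, singleton_subset_iff]
    split_ifs with hqi
    · rfl
    · rw [Edge.outgoing_eq_zero _ fun hi => hqi ((e i).ends_subset_carrier hi)]

end IsNonCrossing

theorem coord_linear_sub {ι E : Type*} [DecidableEq ι] [AddCommGroup E] [Module ℝ E]
    (b : AffineBasis ι ℝ E) (i j k : ι) :
    (b.coord i).linear (b j - b k) = (if i = j then 1 else 0) - if i = k then 1 else 0 := by
  rw [← vsub_eq_sub, AffineMap.linearMap_vsub, b.coord_apply, b.coord_apply, vsub_eq_sub]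

theorem forall_fin_three_cyclic {p : Fin 3 → Prop} (k : Fin 3) :
    (∀ i, p i) ↔ p k ∧ p (k + 1) ∧ p (k + 2) := by
  rw [← (Equiv.addLeft k).forall_congr_right, Fin.forall_fin_succ]
  simp [Fin.forall_fin_succ]

theorem exists_fin_three_cyclic {p : Fin 3 → Prop} (k : Fin 3) :
    (∃ i, p i) ↔ p k ∨ p (k + 1) ∨ p (k + 2) := by
  have := forall_fin_three_cyclic (p := fun i => ¬ p i) k
  grind

/-- The kinds of edges attached to a vertex `k` of a triangle: the two rays into which the line
through the other vertices splits off the triangle, the side opposite to `k`, and the segment from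
`k` to the centroid. -/
inductive EdgeKind
  | ray (s : Bool)
  | side
  | median
  deriving DecidableEq

section Triangle

variable (b : AffineBasis (Fin 3) ℝ (Space 2))

/-- The edges attached to the vertices of the triangle `b`. -/
noncomputable def triangleEdge : Fin 3 × EdgeKind → Edge 2
  | (k, .ray true) =>
    ⟨b (k + 2), b (k + 2) - b (k + 1), ⊤, sub_ne_zero.2 (b.ind.injective.ne (by simp)), by simp⟩
  | (k, .ray false) =>
    ⟨b (k + 1), b (k + 1) - b (k + 2), ⊤, sub_ne_zero.2 (b.ind.injective.ne (by simp)), by simp⟩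
  | (k, .side) =>
    ⟨b (k + 1), b (k + 2) - b (k + 1), 1, sub_ne_zero.2 (b.ind.injective.ne (by simp)), one_pos⟩
  | (k, .median) =>
    ⟨b k, (b (k + 1) - b k) + (b (k + 2) - b k), (1 / 3 : ℝ),
      fun h => absurd (congr_arg (b.coord (k + 1)).linear h) (by
        rw [map_add, coord_linear_sub, coord_linear_sub]; simp),
      by norm_cast; norm_num⟩

/-- The affine form that cuts out the line spanned by an edge. -/
noncomputable def lineForm : Fin 3 × EdgeKind → Space 2 → ℝ
  | (k, .median) => fun x => b.coord (k + 1) x - b.coord (k + 2) x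
  | (k, _) => b.coord k

/-- The time at which the traversal of an edge, extended to all times, passes through a point of
the line spanned by the edge. -/
noncomputable def position : Fin 3 × EdgeKind → Space 2 → ℝ
  | (k, .ray true) => fun x => -b.coord (k + 1) x
  | (k, .ray false) => fun x => -b.coord (k + 2) x
  | (k, .side) => b.coord (k + 2)
  | (k, .median) => b.coord (k + 1)

variable {b} {i : Fin 3 × EdgeKind} {k : Fin 3} {x : Space 2} {t : ℝ}

theorem base_add_smul_dir_eq_iff : (triangleEdge b i).base + t • (triangleEdge b i).dir = x ↔
    lineForm b i x = 0 ∧ position b i x = t := by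
  obtain ⟨k, c⟩ := i
  have hx := coord_add_coord_add_coord b k x
  have hext {p u} : p + t • u = x ↔ ∀ i, b.coord i p + t * (b.coord i).linear u = b.coord i x := by
    simp only [← apply_add_smul]
    exact ⟨fun h _ => h ▸ rfl, b.ext_elem⟩
  rw [hext, forall_fin_three_cyclic k]
  rcases c with (_ | _) | _ | _ <;>
    simp only [triangleEdge, lineForm, position, map_add, coord_linear_sub, b.coord_apply,
      left_eq_add, add_eq_left, add_right_inj, one_ne_zero, Fin.reduceEq, ↓reduceIte, sub_self,
      sub_zero, zero_sub, mul_one, mul_zero, mul_neg, add_zero, zero_add] <;>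
    exact ⟨fun ⟨_, _, _⟩ => ⟨by linarith, by linarith⟩,
      fun ⟨_, _⟩ => ⟨by linarith, by linarith, by linarith⟩⟩

theorem mem_carrier_triangleEdge : x ∈ (triangleEdge b i).carrier ↔
    lineForm b i x = 0 ∧ 0 ≤ position b i x ∧ position b i x ≤ (triangleEdge b i).length := by
  simp only [Edge.carrier, base_add_smul_dir_eq_iff, mem_ofPred_eq]
  grind

theorem mem_ends_triangleEdge : x ∈ (triangleEdge b i).ends ↔
    lineForm b i x = 0 ∧ (position b i x = 0 ∨ position b i x = (triangleEdge b i).length) := by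
  simp only [Edge.ends, base_add_smul_dir_eq_iff, mem_ofPred_eq]
  grind

theorem mem_carrier_ray_true : x ∈ (triangleEdge b (k, .ray true)).carrier ↔
    b.coord k x = 0 ∧ b.coord (k + 1) x ≤ 0 := by
  rw [mem_carrier_triangleEdge]
  simp [lineForm, position, triangleEdge]

theorem mem_ends_ray_true : x ∈ (triangleEdge b (k, .ray true)).ends ↔
    b.coord k x = 0 ∧ b.coord (k + 1) x = 0 := by
  rw [mem_ends_triangleEdge]
  simp [lineForm, position, triangleEdge]

theorem mem_carrier_ray_false : x ∈ (triangleEdge b (k, .ray false)).carrier ↔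
    b.coord k x = 0 ∧ b.coord (k + 2) x ≤ 0 := by
  rw [mem_carrier_triangleEdge]
  simp [lineForm, position, triangleEdge]

theorem mem_ends_ray_false : x ∈ (triangleEdge b (k, .ray false)).ends ↔
    b.coord k x = 0 ∧ b.coord (k + 2) x = 0 := by
  rw [mem_ends_triangleEdge]
  simp [lineForm, position, triangleEdge]

theorem mem_carrier_side : x ∈ (triangleEdge b (k, .side)).carrier ↔
    b.coord k x = 0 ∧ 0 ≤ b.coord (k + 1) x ∧ 0 ≤ b.coord (k + 2) x := by
  have hsum := coord_add_coord_add_coord b k x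
  rw [mem_carrier_triangleEdge]
  simp only [lineForm, position, triangleEdge, WithTop.coe_le_one]
  generalize b.coord k x = u, b.coord (k + 1) x = v, b.coord (k + 2) x = w at hsum ⊢
  grind

theorem mem_ends_side : x ∈ (triangleEdge b (k, .side)).ends ↔
    b.coord k x = 0 ∧ (b.coord (k + 1) x = 0 ∨ b.coord (k + 2) x = 0) := by
  have hsum := coord_add_coord_add_coord b k x
  rw [mem_ends_triangleEdge]
  simp only [lineForm, position, triangleEdge, WithTop.coe_eq_one]
  generalize b.coord k x = u, b.coord (k + 1) x = v, b.coord (k + 2) x = w at hsum ⊢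
  grind

theorem mem_carrier_median : x ∈ (triangleEdge b (k, .median)).carrier ↔
    b.coord (k + 1) x = b.coord (k + 2) x ∧ 0 ≤ b.coord (k + 1) x ∧
      b.coord (k + 1) x ≤ b.coord k x := by
  have hsum := coord_add_coord_add_coord b k x
  rw [mem_carrier_triangleEdge]
  simp only [lineForm, position, triangleEdge, sub_eq_zero, WithTop.coe_le_coe]
  generalize b.coord k x = u, b.coord (k + 1) x = v, b.coord (k + 2) x = w at hsum ⊢
  grind

theorem mem_ends_median : x ∈ (triangleEdge b (k, .median)).ends ↔
    b.coord (k + 1) x = b.coord (k + 2) x ∧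
      (b.coord (k + 1) x = 0 ∨ b.coord (k + 1) x = b.coord k x) := by
  have hsum := coord_add_coord_add_coord b k x
  rw [mem_ends_triangleEdge]
  simp only [lineForm, position, triangleEdge, sub_eq_zero, WithTop.coe_inj]
  generalize b.coord k x = u, b.coord (k + 1) x = v, b.coord (k + 2) x = w at hsum ⊢
  grind

theorem isNonCrossing_triangleEdge : IsNonCrossing (triangleEdge b) := by
  rintro ⟨k, c⟩ ⟨k', c'⟩ hne x ⟨hx, hx'⟩
  have hsum := coord_add_coord_add_coord b k x
  revert k'
  rw [forall_fin_three_cyclic k]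
  rcases c with (_ | _) | _ | _ <;> rcases c' with (_ | _) | _ | _ <;>
    simp only [mem_carrier_ray_true, mem_carrier_ray_false, mem_carrier_side, mem_carrier_median,
      mem_ends_ray_true, mem_ends_ray_false, mem_ends_side, mem_ends_median,
      add_assoc, add_zero, Fin.reduceAdd] at hx ⊢ <;>
    generalize b.coord k x = u, b.coord (k + 1) x = v, b.coord (k + 2) x = w at hsum hx ⊢ <;>
    grind

end Triangle

section TriangleComplexes

variable (b : AffineBasis (Fin 3) ℝ (Space 2))

/-- The six rays in which the lines spanned by the sides of a triangle leave it. -/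
noncomputable def outerRays : WeightedComplex 2 :=
  (isNonCrossing_triangleEdge (b := b)).complex
    (Finset.univ ×ˢ {.ray true, .ray false})

/-- The line spanned by the side of a triangle opposite to the vertex `k`. -/
noncomputable def sideLine (k : Fin 3) : WeightedComplex 2 :=
  (isNonCrossing_triangleEdge (b := b)).complex
    ({k} ×ˢ {.ray true, .ray false, .side})

/-- The three lines spanned by the sides of a triangle. -/
noncomputable def sideLines : WeightedComplex 2 :=
  (isNonCrossing_triangleEdge (b := b)).complex
    (Finset.univ ×ˢ {.ray true, .ray false, .side})

/-- The outer rays of a triangle, with the vertices joined to the centroid. -/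
noncomputable def medianTree : WeightedComplex 2 :=
  (isNonCrossing_triangleEdge (b := b)).complex
    (Finset.univ ×ˢ {.ray true, .ray false, .median})

theorem sum_outgoing_side (k : Fin 3) :
    ∑ c ∈ {.ray true, .ray false, .side}, (triangleEdge b (k, c)).outgoing = 0 := by
  classical
  simp (disch := decide) only [Finset.sum_insert, Finset.sum_singleton]
  rw [Edge.outgoing_of_length_eq_top (e := triangleEdge b (k, .ray true)) rfl,
    Edge.outgoing_of_length_eq_top (e := triangleEdge b (k, .ray false)) rfl,
    Edge.outgoing_of_length_eq_coe (e := triangleEdge b (k, .side)) (t := 1) rfl]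
  simp only [triangleEdge, Pi.single_sub, one_smul, add_sub_cancel]
  abel

theorem sum_outgoing_median :
    ∑ i, ∑ c ∈ {.ray true, .ray false, .median}, (triangleEdge b (i, c)).outgoing = 0 := by
  classical
  have hcentroid (k : Fin 3) : b k + (1 / 3 : ℝ) • ((b (k + 1) - b k) + (b (k + 2) - b k)) =
      (1 / 3 : ℝ) • ∑ i, b i := by
    rw [sum_fin_three_cyclic k]
    module
  simp (disch := decide) only [Finset.sum_insert, Finset.sum_singleton]
  simp only [fun k => Edge.outgoing_of_length_eq_top (e := triangleEdge b (k, .ray true)) rfl,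
    fun k => Edge.outgoing_of_length_eq_top (e := triangleEdge b (k, .ray false)) rfl,
    fun k => Edge.outgoing_of_length_eq_coe (e := triangleEdge b (k, .median)) rfl]
  simp only [triangleEdge, hcentroid, Pi.single_sub, Pi.single_add, Fin.sum_univ_three,
    Fin.reduceAdd, zero_add]
  abel

theorem balanced_sideLine (k : Fin 3) : (sideLine b k).Balanced := by
  refine IsNonCrossing.balanced_complex _ _ ?_
  rw [Finset.sum_product, Finset.sum_singleton, sum_outgoing_side]

theorem isBalancing_sideLines : (outerRays b).IsBalancing (sideLines b) := by
  refine ⟨IsNonCrossing.balanced_complex _ _ ?_, IsNonCrossing.weightLE_complex _ ?_⟩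
  · rw [Finset.sum_product, Finset.sum_eq_zero fun k _ => sum_outgoing_side b k]
  · exact Finset.product_subset_product_right (by decide)

theorem isBalancing_medianTree : (outerRays b).IsBalancing (medianTree b) := by
  refine ⟨IsNonCrossing.balanced_complex _ _ ?_, IsNonCrossing.weightLE_complex _ ?_⟩
  · rw [Finset.sum_product, sum_outgoing_median]
  · exact Finset.product_subset_product_right (by decide)

theorem isSum_sideLine : (sideLines b).IsSum (sideLine b) := by
  have hfiber (T : Finset EdgeKind) (k : Fin 3) :
      {i ∈ (Finset.univ : Finset (Fin 3)) ×ˢ T | i.1 = k} = {k} ×ˢ T := by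
    rw [Finset.filter_product_left (· = k), Finset.filter_eq', if_pos (Finset.mem_univ k)]
  have hsum := isNonCrossing_triangleEdge (b := b) |>.isSum_complex
    (Finset.univ ×ˢ {.ray true, .ray false, .side}) Prod.fst
  simp only [hfiber] at hsum
  exact hsum

variable {b} {x : Space 2}

theorem mem_support_sideLine {k : Fin 3} : x ∈ (sideLine b k).support ↔ b.coord k x = 0 := by
  have hsum := coord_add_coord_add_coord b k x
  simp only [sideLine, Finset.singleton_product, Finset.map_insert, Finset.map_singleton,
    Function.Embedding.coeFn_mk, IsNonCrossing.support_complex, Finset.set_biUnion_insert,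
    Finset.set_biUnion_singleton, mem_union, mem_carrier_ray_true, mem_carrier_ray_false,
    mem_carrier_side]
  generalize b.coord k x = u, b.coord (k + 1) x = v, b.coord (k + 2) x = w at hsum ⊢
  grind

theorem mem_support_medianTree : x ∈ (medianTree b).support ↔
    ∃ k, (b.coord k x = 0 ∧ (b.coord (k + 1) x ≤ 0 ∨ b.coord (k + 2) x ≤ 0)) ∨
      (b.coord (k + 1) x = b.coord (k + 2) x ∧ 0 ≤ b.coord (k + 1) x ∧
        b.coord (k + 1) x ≤ b.coord k x) := by
  simp only [medianTree, IsNonCrossing.support_complex, mem_iUnion₂, Finset.mem_product,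
    Finset.mem_singleton, Finset.mem_insert, Finset.mem_univ, true_and, exists_prop, Prod.exists,
    exists_eq_left, exists_eq_or_imp, mem_carrier_ray_true, mem_carrier_ray_false,
    mem_carrier_median, and_or_left, or_assoc]

theorem convex_setOf_lt {E : Type*} [AddCommGroup E] [Module ℝ E] (f g : E →ᵃ[ℝ] ℝ) :
    Convex ℝ {x | f x < g x} := by
  have hpreimage : {x | f x < g x} = (g - f) ⁻¹' Ioi 0 := by
    ext x
    simp
  rw [hpreimage]
  exact (convex_Ioi 0).affine_preimage _

theorem mlen_sideLine_le (k : Fin 3) : (sideLine b k).mlen ≤ 2 := by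
  have hcompl : (sideLine b k).supportᶜ =
      ⋃ s : Bool, if s then {x | 0 < b.coord k x} else {x | b.coord k x < 0} := by
    ext x
    simp [mem_support_sideLine, lt_or_lt_iff_ne, eq_comm]
  refine (card_connectedComponents_le (fun s => ?_) hcompl).trans_eq (by simp)
  split_ifs
  · exact (convex_setOf_lt 0 (b.coord k)).isPreconnected
  · exact (convex_setOf_lt (b.coord k) 0).isPreconnected

theorem flen_sideLines_le : (sideLines b).flen ≤ 4 := by
  refine iInf₂_le_of_le 2 (sideLine b) <|
    iInf₂_le_of_le (balanced_sideLine b) (isSum_sideLine b) ?_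
  rw [tsub_le_iff_right]
  exact (Finset.sum_le_card_nsmul _ _ 2 fun k _ => mlen_sideLine_le k).trans (by norm_num)

theorem compl_support_medianTree : (medianTree b).supportᶜ = ⋃ s : Fin 3 ⊕ Fin 3,
    s.elim (fun k => {x | b.coord (k + 1) x < 0} ∩ {x | b.coord (k + 2) x < 0})
      fun k => ({x | 0 < b.coord (k + 1) x} ∩ {x | 0 < b.coord (k + 2) x}) ∩
        ({x | b.coord k x < b.coord (k + 1) x} ∩ {x | b.coord k x < b.coord (k + 2) x}) := by
  ext x
  have hsum := coord_add_coord_add_coord b 0 x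
  simp only [mem_compl_iff, mem_support_medianTree, mem_iUnion, Sum.exists, Sum.elim_inl,
    Sum.elim_inr, mem_inter_iff, mem_ofPred_eq, exists_fin_three_cyclic 0, add_assoc,
    Fin.reduceAdd, zero_add] at hsum ⊢
  generalize b.coord 0 x = u, b.coord 1 x = v, b.coord 2 x = w at hsum ⊢
  grind

theorem mlen_medianTree_le : (medianTree b).mlen ≤ 6 := by
  refine (card_connectedComponents_le (fun s => ?_) compl_support_medianTree).trans_eq (by simp)
  rcases s with k | k
  · exact ((convex_setOf_lt _ 0).inter (convex_setOf_lt _ 0)).isPreconnected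
  · exact (((convex_setOf_lt 0 _).inter (convex_setOf_lt 0 _)).inter
      ((convex_setOf_lt _ _).inter (convex_setOf_lt _ _))).isPreconnected

end TriangleComplexes

section LowerBound

variable {b : AffineBasis (Fin 3) ℝ (Space 2)}

/-- The equation of the line spanned by an outer ray, signed in such a way that of any two outer
rays on different lines, one lies on the negative side of the line spanned by the other. -/
noncomputable def rayForm (b : AffineBasis (Fin 3) ℝ (Space 2)) : Fin 3 × Bool → Space 2 →ᵃ[ℝ] ℝ
  | (k, true) => -b.coord k
  | (k, false) => b.coord k

theorem rayForm_neg {k : Fin 3} {s : Bool} {t : ℝ} (ht : 0 < t) {x : Space 2}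
    (hx : (triangleEdge b (k, .ray s)).base + t • (triangleEdge b (k, .ray s)).dir = x) :
    rayForm b (k + 1, !s) x < 0 ∧ rayForm b (k + 2, s) x < 0 := by
  have ⟨hline, hpos⟩ := base_add_smul_dir_eq_iff.1 hx
  have hsum := coord_add_coord_add_coord b k x
  cases s <;> simp only [lineForm, position, rayForm, Bool.not_true, Bool.not_false,
    AffineMap.coe_neg, Pi.neg_apply] at * <;> constructor <;> linarith

theorem pairwise_rayForm : Pairwise fun i j : Fin 3 × Bool => rayForm b j = -rayForm b i ∨
    (∀ t > (0 : ℝ), rayForm b i ((triangleEdge b (j.1, .ray j.2)).base +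
      t • (triangleEdge b (j.1, .ray j.2)).dir) < 0) ∨
    ∀ t > (0 : ℝ), rayForm b j ((triangleEdge b (i.1, .ray i.2)).base +
      t • (triangleEdge b (i.1, .ray i.2)).dir) < 0 := by
  rintro ⟨k, s⟩ ⟨j, s'⟩ hne
  revert j
  rw [forall_fin_three_cyclic k]
  obtain rfl | rfl : s' = s ∨ s' = !s := by cases s <;> cases s' <;> simp
  · refine ⟨fun h => absurd rfl h, fun _ => .inr <| .inl fun t ht => ?_,
      fun _ => .inr <| .inr fun t ht => (rayForm_neg ht rfl).2⟩
    simpa [add_assoc] using (rayForm_neg (b := b) (k := k + 1) ht rfl).2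
  · refine ⟨fun _ => .inl ?_, fun _ => .inr <| .inr fun t ht => (rayForm_neg ht rfl).1,
      fun _ => .inr <| .inl fun t ht => ?_⟩
    · cases s <;> simp [rayForm]
    · simpa [add_assoc] using (rayForm_neg (b := b) (k := k + 2) (s := !s) ht rfl).1

theorem rayForm_linear_ne_zero (i : Fin 3 × Bool) : (rayForm b i).linear ≠ 0 := by
  obtain ⟨k, s⟩ := i
  intro h
  have := DFunLike.congr_fun h (b (k + 1) - b k)
  cases s <;>
    simp [rayForm, -map_sub, -AffineBasis.linear_eq_sumCoords, coord_linear_sub] at this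

theorem mem_support_outerRays (k : Fin 3) (s : Bool) {t : ℝ} (ht : 0 ≤ t) :
    (triangleEdge b (k, .ray s)).base + t • (triangleEdge b (k, .ray s)).dir ∈
      (outerRays b).support := by
  rw [outerRays, IsNonCrossing.support_complex]
  refine mem_biUnion (x := (k, .ray s)) (by simp) ⟨t, ht, ?_, rfl⟩
  cases s <;> exact le_top

theorem seven_le_mlen {Y : WeightedComplex 2} (hY : (outerRays b).IsBalancing Y)
    (hflen : Y.flen ≤ 4) : 7 ≤ Y.mlen := by
  refine WeightedComplex.two_pow_sub_one_le_mlen b fun k x hx => ?_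
  refine WeightedComplex.mem_support_of_flen_le (m := 4) (f := rayForm b)
    (a := fun i => (triangleEdge b (i.1, .ray i.2)).base)
    (v := fun i => (triangleEdge b (i.1, .ray i.2)).dir) (i := (k, false)) hflen (by simp)
    rayForm_linear_ne_zero ?_ (fun i => (triangleEdge b _).dir_ne_zero) ?_ ?_ pairwise_rayForm hx
  · rintro ⟨k, _ | _⟩ <;> simp [rayForm, triangleEdge, b.coord_apply]
  · rintro ⟨k, _ | _⟩ <;>
      simp only [rayForm, triangleEdge, AffineMap.neg_linear, LinearMap.neg_apply,
        coord_linear_sub] <;> simp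
  · exact fun i => (eventually_ge_atTop 0).mono fun t ht =>
      WeightedComplex.WeightLE.support_subset hY.2 (mem_support_outerRays i.1 i.2 ht)

end LowerBound

end TropicalBalancing

theorem theorem2 :
    ∃ X Y₁ Y₂ : TropicalBalancing.WeightedComplex 2,
      TropicalBalancing.WeightedComplex.IsMinimalBalancing
        TropicalBalancing.WeightedComplex.mlen X Y₁ ∧
      TropicalBalancing.WeightedComplex.IsMinimalBalancing
        TropicalBalancing.WeightedComplex.flen X Y₂ ∧
      Y₁.mlen < Y₂.mlen ∧ Y₂.flen < Y₁.flen := by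
  open TropicalBalancing WeightedComplex in
  obtain ⟨b⟩ : Nonempty (AffineBasis (Fin 3) ℝ (Space 2)) :=
    AffineBasis.exists_affineBasis_of_finiteDimensional (by simp)
  obtain ⟨Y₁, h₁, hle₁⟩ := exists_isMinimalBalancing mlen (isBalancing_medianTree b)
  obtain ⟨Y₂, h₂, hle₂⟩ := exists_isMinimalBalancing flen (isBalancing_sideLines b)
  have hmlen : Y₁.mlen < 7 := (hle₁.trans mlen_medianTree_le).trans_lt (by norm_num)
  have hflen : Y₂.flen ≤ 4 := hle₂.trans flen_sideLines_le
  refine ⟨outerRays b, Y₁, Y₂, h₁, h₂, hmlen.trans_le (seven_le_mlen h₂.1 hflen), ?_⟩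
  by_contra! hle
  exact hmlen.not_ge (seven_le_mlen h₁.1 (hle.trans hflen))
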